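/- Let $K$ be an algebraically closed field (of any characteristic), let $B_3=\langle\sigma_1,\sigma_2\mid\sigma_1\sigma_2\sigma_1=\sigma_2\sigma_1\sigma_2\rangle$, and let $1\le d\le 5$. Let $\zeta=(\sigma_1\sigma_2)^3$ (a central element). For a $B_3$-module let $A$ and $B$ be the images of $\sigma_1$ and $\sigma_2$. Parameters. Let $X_d$ be the set of $\lambda=(\lambda_1,\dots,\lambda_d)\in (K^{\times})^d$ if $d\le 3$; of pairs $(\lambda,\gamma^2)$ with $\lambda\in(K^\times)^4$ and $\gamma^2\in K$ a square root of $\lambda_1\lambda_2\lambda_3\lambda_4$ if $d=4$ (the datum is the element $\gamma^2$, not $\gamma$); and of pairs $(\lambda,\gamma)$ with $\lambda\in(K^\times)^5$ and $\gamma^5=\lambda_1\cdots\lambda_5$ if $d=5$. The symmetric group $S_d$ acts on $X_d$ by permuting the $\lambda_i$. A $d$-dimensional $B_3$-module $V$ has parameter $x\in X_d$ if the characteristic polynomial of $A$ is $\prod_i(t-\lambda_i)$ and moreover $\zeta$ acts on $V$ as the scalar $-(\gamma^2)^3$ if $d=4$, and as the scalar $\gamma^6$ if $d=5$. For $r\ne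 s$ put $$Q^{(2)}_{rs}=-\lambda_r^2+\lambda_r\lambda_s-\lambda_s^2,\qquad Q^{(3)}_{rs}=(\lambda_r^2+\lambda_s\lambda_k)(\lambda_s^2+\lambda_r\lambda_k)\quad(\{r,s,k\}=\{1,2,3\}),$$ $$Q^{(4)}_{rs}=-\gamma^{-2}(\lambda_r^2+\gamma^2)(\lambda_s^2+\gamma^2)(\gamma^2+\lambda_r\lambda_k+\lambda_s\lambda_l)(\gamma^2+\lambda_r\lambda_l+\lambda_s\lambda_k)\quad(\{r,s,k,l\}=\{1,2,3,4\}),$$ $$Q^{(5)}_{rs}=\gamma^{-8}(\gamma^2+\lambda_r\gamma+\lambda_r^2)(\gamma^2+\lambda_s\gamma+\lambda_s^2)\prod_{k\ne r,s}(\gamma^2+\lambda_r\lambda_k)(\gamma^2+\lambda_s\lambda_k).$$ Theorem. (a) Every simple $B_3$-module of dimension $d$ has a parameter in $X_d$, and its parameters form exactly one $S_d$-orbit. Two simple $B_3$-modules of dimension $d$ are equivalent if and only if they have a common parameter; that is, a simple module is determined up to equivalence by the eigenvalues of $A$ together with, for $d=4$, the square root $\gamma^2$ of $\det A$ and, for $d=5$,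 the fifth root $\gamma$ of $\det A$. (b) For $x\in X_d$ a simple $B_3$-module of dimension $d$ with parameter $x$ exists if and only if $Q_{rs}^{(d)}(x)\ne 0$ for all $r\ne s$ in $\{1,\dots,d\}$ (no condition for $d=1$). The $\lambda_i$ need not be distinct. (c) With $P_r(t)=\prod_{i\ne r}(t-\lambda_i)$, every simple module with parameter $x$ satisfies $P_r(A)\neq 0$ and $P_r(A)P_s(B)P_r(A)=Q_{rs}^{(d)}(x)\,P_r(A)$ for all $r\ne s$. (d) Let $N_d$ be the set of points at which at least one of the following polynomials vanishes: none for $d=1$; $\lambda_1^2-\lambda_1\lambda_2+\lambda_2^2$ for $d=2$; $\lambda_i^2+\lambda_r\lambda_s$ with $\{i,r,s\}=\{1,2,3\}$ for $d=3$; $\lambda_i^2+\gamma^2$ $(1\le i\le 4)$ and $\gamma^2+\lambda_i\lambda_j+\lambda_r\lambda_s$ with $\{i,j,r,s\}=\{1,2,3,4\}$ for $d=4$; $\gamma^2+\gamma\lambda_i+\lambda_i^2$ $(1\le i\le 5)$ and $\gamma^2+\lambda_i\lambda_j$ $(1\le i<j\le 5)$ for $d=5$. There is a bijection between the equivalence classes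 of simple $B_3$-modules of dimension $d$ and the $S_d$-orbits in $X_d\setminus N_d$ under which the class of $V$ corresponds to the orbit of $x$ if and only if $V$ has parameter $x$. -/

import Mathlib

open Polynomial

/-- The braid relation `σ₁σ₂σ₁ = σ₂σ₁σ₂`, as a one-element set of relators in the free group
on `σ₁` (index `0`) and `σ₂` (index `1`). -/
def braidRelators : Set (FreeGroup (Fin 2)) :=
  {FreeGroup.of 0 * FreeGroup.of 1 * FreeGroup.of 0 *
    (FreeGroup.of 1 * FreeGroup.of 0 * FreeGroup.of 1)⁻¹}

/-- Artin's braid group on three strands. -/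
abbrev B3 : Type := PresentedGroup braidRelators

namespace B3

/-- The first standard generator. -/
def σ₁ : B3 := PresentedGroup.of 0

/-- The second standard generator. -/
def σ₂ : B3 := PresentedGroup.of 1

/-- The central element `(σ₁σ₂)³`. -/
def ζ : B3 := (σ₁ * σ₂) ^ 3

/-- Pairs `(l, g)`: the list `l` of eigenvalues and the extra parameter `g`, which is the square
root `γ²` of the determinant for `d = 4` and the fifth root `γ` of the determinant for `d = 5`.
For the other `d` there is no extra parameter, and `g` is the constant `1`
(see `paramSpace`). -/
abbrev Param (K : Type*) (d : ℕ) : Type _ := (Fin d → K) × K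

section

variable {K : Type*} [Field K]

/-- The condition on the extra parameter. -/
def IsRoot : {d : ℕ} → Param K d → Prop
  | 4, (l, g) => g ^ 2 = ∏ i, l i
  | 5, (l, g) => g ^ 5 = ∏ i, l i
  | _, (_, g) => g = 1

variable (K) in
/-- The parameter space `X_d`: nonzero eigenvalues together with a choice of root. -/
def paramSpace (d : ℕ) : Set (Param K d) :=
  {p | (∀ i, p.1 i ≠ 0) ∧ IsRoot p}

/-- The Laurent polynomials `Q_{rs}^{(d)}` (only meaningful for `r ≠ s` and `2 ≤ d ≤ 5`).
For `r ≠ s` the product for `d = 3` has one factor, and the product over ordered pairs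
`(k, m)` with `{r, s, k, m} = {1, 2, 3, 4}` for `d = 4` has two. -/
def Q : {d : ℕ} → Param K d → Fin d → Fin d → K
  | 2, (l, _), r, s => -l r ^ 2 + l r * l s - l s ^ 2
  | 3, (l, _), r, s =>
      ∏ k ∈ ({r, s} : Finset (Fin 3))ᶜ, ((l r ^ 2 + l s * l k) * (l s ^ 2 + l r * l k))
  | 4, (l, g), r, s =>
      -g⁻¹ * (l r ^ 2 + g) * (l s ^ 2 + g) *
        ∏ p ∈ (({r, s} : Finset (Fin 4))ᶜ).offDiag, (g + l r * l p.1 + l s * l p.2)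
  | 5, (l, g), r, s =>
      (g ^ 8)⁻¹ * (g ^ 2 + l r * g + l r ^ 2) * (g ^ 2 + l s * g + l s ^ 2) *
        ∏ k ∈ ({r, s} : Finset (Fin 5))ᶜ, ((g ^ 2 + l r * l k) * (g ^ 2 + l s * l k))
  | _, _, _, _ => 1

/-- `p` is a zero of one of the polynomials that cut out the excluded locus. -/
def IsExcluded : {d : ℕ} → Param K d → Prop
  | 2, (l, _) => l 0 ^ 2 - l 0 * l 1 + l 1 ^ 2 = 0
  | 3, (l, _) => ∃ i r s : Fin 3, i ≠ r ∧ i ≠ s ∧ r ≠ s ∧ l i ^ 2 + l r * l s = 0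
  | 4, (l, g) => (∃ i, l i ^ 2 + g = 0) ∨
      ∃ i j r s : Fin 4, [i, j, r, s].Nodup ∧ g + l i * l j + l r * l s = 0
  | 5, (l, g) => (∃ i, g ^ 2 + g * l i + l i ^ 2 = 0) ∨
      ∃ i j : Fin 5, i < j ∧ g ^ 2 + l i * l j = 0
  | _, _ => False

variable (K) in
/-- The excluded locus `N_d`. -/
def excludedLocus (d : ℕ) : Set (Param K d) := {p | IsExcluded p}

/-- Two parameters are in the same orbit of the symmetric group, which permutes the
eigenvalues and fixes the extra parameter. -/
def SameOrbit {d : ℕ} (p q : Param K d) : Prop :=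
  ∃ π : Equiv.Perm (Fin d), q.1 = p.1 ∘ π ∧ q.2 = p.2

variable (K) in
/-- The orbit relation on `X_d \ N_d`. -/
def orbitSetoid (d : ℕ) : Setoid ↥(paramSpace K d \ excludedLocus K d) where
  r p q := SameOrbit p.1 q.1
  iseqv :=
    { refl := fun _ => ⟨1, rfl, rfl⟩
      symm := by
        rintro p q ⟨π, h1, h2⟩
        refine ⟨π⁻¹, ?_, h2.symm⟩
        rw [h1]
        funext i
        simp
      trans := by
        rintro p q r ⟨π, h1, h2⟩ ⟨τ, h3, h4⟩
        refine ⟨π * τ, ?_, h4.trans h2⟩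
        rw [h3, h1]
        rfl }

variable (K) in
/-- The set of orbits of the symmetric group in `X_d \ N_d`. -/
abbrev ParamOrbits (d : ℕ) : Type _ := Quotient (orbitSetoid K d)

/-- How the central element acts in a representation whose extra parameter is `g`. -/
def CentralCondition {V : Type*} [AddCommGroup V] [Module K V] (ρ : Representation K B3 V) :
    {d : ℕ} → Param K d → Prop
  | 4, (_, g) => ρ ζ = (-g ^ 3) • (1 : Module.End K V)
  | 5, (_, g) => ρ ζ = (g ^ 6) • (1 : Module.End K V)
  | _, _ => True

/-- `ρ` has parameter `p = (l, g)`: the eigenvalues of `A = ρ σ₁` with multiplicity are the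
`l i`, and `g` is the root of `det A` that belongs to `ρ`: the central element acts as the scalar
`-(γ²)³` for `d = 4` and `γ⁶` for `d = 5`. -/
structure HasParam {V : Type*} [AddCommGroup V] [Module K V] [FiniteDimensional K V]
    (ρ : Representation K B3 V) {d : ℕ} (p : Param K d) : Prop where
  charpoly_eq : LinearMap.charpoly (ρ σ₁) = ∏ i, (X - C (p.1 i))
  mem : p ∈ paramSpace K d
  central : CentralCondition ρ p

/-- The polynomial `P_r(x) = ∏_{i ≠ r} (x - l i)`. -/
noncomputable def P {d : ℕ} (l : Fin d → K) (r : Fin d) : K[X] :=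
  ∏ i ∈ Finset.univ.erase r, (X - C (l i))

variable (K) in
/-- Equivalence of simple representations of `B3` on `K^d`. -/
def simpleSetoid (d : ℕ) :
    Setoid {ρ : Representation K B3 (Fin d → K) // ρ.IsIrreducible} where
  r ρ τ := Nonempty (ρ.1.Equiv τ.1)
  iseqv :=
    { refl := fun ρ => ⟨.refl ρ.1⟩
      symm := fun ⟨e⟩ => ⟨e.symm⟩
      trans := fun ⟨e⟩ ⟨f⟩ => ⟨e.trans f⟩ }

variable (K) in
/-- The set of equivalence classes of simple `B3`-modules of dimension `d`
(each of them is represented on `K^d`). -/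
abbrev SimpleClasses (d : ℕ) : Type _ := Quotient (simpleSetoid K d)

end

end B3

/-! The elements δ = σ₁σ₂σ₁ and τ = σ₁σ₂ generate the group, δ² = τ³ = ζ, and σ₁ = τ⁻¹δ. On a simple
module the central ζ is a scalar c, so the module amounts to a pair S, T with S² = T³ = c and no
common invariant subspace (`IsSimplePair`). An eigenvector u of σ₁ satisfies Su = lTu. In dimension
d ≤ 5 the first d of the vectors u, Tu, T²u, w = c⁻¹ST²u, Tw form a basis, since a shorter initial
segment with a dependent successor would span a stable subspace. In this basis S² = T³ = c forces
most entries of S and T, and det(xT - S) = det T · det(x - σ₁) determines the others from the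
remaining eigenvalues and γ. Hence every simple module is equivalent to an explicit `modelRep`
(`IsSimplePair.exists_model_basis`, `exists_equiv_modelRep`), which gives the parameter, and the
parameter determines the module.

In the model the first basis vector e₀ is a σ₁-eigenvector for λ₀, and P₀(A)P₁(B)e₀ = Q₀₁e₀ is a
computation valid at every parameter, whether or not the model is simple (`modelRep_identity_one`).
Symmetry in the eigenvalues supplies the other indices.

Necessity of Q ≠ 0: on a simple module of dimension at most 5 the eigenspaces of σ₁ are lines
(`IsSimplePair.mem_span_singleton_of_eigenvector`). Therefore P_s(B)u ≠ 0 for every λ_r-eigenvector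
u of A. If Q_rs = 0, then δP_s(B)u is a λ_s-eigenvector of A killed by P_r(B), which is the same
statement violated with r and s exchanged (`HasParam.Q_ne_zero`).

Sufficiency: a proper invariant subspace splits the characteristic polynomial of A, and this makes
P₀(A)P_s(B) or P_s(B)P₀(A) vanish for some s ≠ 0; the identity at e₀ excludes both
(`isIrreducible_modelRep`). No step needs distinct eigenvalues. -/

namespace B3

/-! ### Pairs S, T with S² = T³ = c, and eigenspaces of T⁻¹S -/

section Pair

variable {K V : Type*} [Field K] [AddCommGroup V] [Module K V]

/-- Operators `S`, `T` with `S ^ 2 = T ^ 3 = c ≠ 0` and without common invariant subspaces. These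
are the images of `σ₁σ₂σ₁` and `σ₁σ₂` in a simple `B3`-module. -/
structure IsSimplePair (c : K) (S T : Module.End K V) : Prop where
  ne_zero : c ≠ 0
  sq : ∀ v, S (S v) = c • v
  cube : ∀ v, T (T (T v)) = c • v
  eq_bot_or_eq_top : ∀ N : Submodule K V, (∀ v ∈ N, S v ∈ N) → (∀ v ∈ N, T v ∈ N) →
    N = ⊥ ∨ N = ⊤

theorem map_mem_span_of_forall_mem {f : Module.End K V} {s : Set V}
    (h : ∀ v ∈ s, f v ∈ Submodule.span K s) :
    ∀ v ∈ Submodule.span K s, f v ∈ Submodule.span K s := by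
  intro v hv
  have : Submodule.span K s ≤ (Submodule.span K s).comap f := Submodule.span_le.2 h
  exact this hv

namespace IsSimplePair

variable {c l : K} {S T : Module.End K V}

theorem injective_S (h : IsSimplePair c S T) : Function.Injective S := by
  intro v w hvw
  have := congrArg S hvw
  rw [h.sq, h.sq] at this
  exact smul_right_injective V h.ne_zero this

theorem injective_T (h : IsSimplePair c S T) : Function.Injective T := by
  intro v w hvw
  have := congrArg (fun x => T (T x)) hvw
  simp only [h.cube] at this
  exact smul_right_injective V h.ne_zero this

theorem apply_S_T (h : IsSimplePair c S T) (hl : l ≠ 0) {u : V} (hu : S u = l • T u) :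
    S (T u) = (c / l) • u := by
  have := h.sq u
  rw [hu, map_smul] at this
  rw [div_eq_inv_mul, mul_smul, ← this, smul_smul, inv_mul_cancel₀ hl, one_smul]

/-- A nonzero vector in a finite set with stable span forces the dimension to be at most the
cardinality of the set. -/
theorem finrank_le_card [FiniteDimensional K V] (h : IsSimplePair c S T) (s : Finset V) {u : V}
    (hu : u ∈ s) (hu0 : u ≠ 0) (hS : ∀ v ∈ s, S v ∈ Submodule.span K (s : Set V))
    (hT : ∀ v ∈ s, T v ∈ Submodule.span K (s : Set V)) : Module.finrank K V ≤ s.card := by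
  rcases h.eq_bot_or_eq_top _ (map_mem_span_of_forall_mem hS) (map_mem_span_of_forall_mem hT)
    with h1 | h1
  · exact absurd ((Submodule.mem_bot K).1 (h1 ▸ Submodule.subset_span hu)) hu0
  · rw [← finrank_top K V, ← h1]
    exact finrank_span_finset_le_card s

theorem finrank_le_one [FiniteDimensional K V] (h : IsSimplePair c S T) {u : V} (hu0 : u ≠ 0)
    (hS : S u ∈ Submodule.span K {u}) (hT : T u ∈ Submodule.span K {u}) :
    Module.finrank K V ≤ 1 := by
  classical
  exact h.finrank_le_card {u} (by simp) hu0 (by simpa using hS) (by simpa using hT)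

theorem finrank_le_two [FiniteDimensional K V] (h : IsSimplePair c S T) (hl : l ≠ 0) {u : V}
    (hu0 : u ≠ 0) (hu : S u = l • T u) (hT : T (T u) ∈ Submodule.span K {u, T u}) :
    Module.finrank K V ≤ 2 := by
  classical
  have hu1 : u ∈ Submodule.span K {u, T u} := Submodule.subset_span (by simp)
  have hu2 : T u ∈ Submodule.span K {u, T u} := Submodule.subset_span (by simp)
  refine (h.finrank_le_card {u, T u} (by simp) hu0 ?_ ?_).trans Finset.card_le_two
  · simp only [Finset.mem_insert, Finset.mem_singleton, forall_eq_or_imp, forall_eq,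
      Finset.coe_insert, Finset.coe_singleton]
    rw [h.apply_S_T hl hu, hu]
    exact ⟨Submodule.smul_mem _ _ hu2, Submodule.smul_mem _ _ hu1⟩
  · simp only [Finset.mem_insert, Finset.mem_singleton, forall_eq_or_imp, forall_eq,
      Finset.coe_insert, Finset.coe_singleton]
    exact ⟨hu2, hT⟩

/-- An eigenspace of `T⁻¹S` meets its image under `T` trivially. -/
theorem eq_zero_of_apply_T [FiniteDimensional K V] (h : IsSimplePair c S T)
    (hd : 1 < Module.finrank K V) (hl : l ≠ 0) {v w : V} (hv : S v = l • T v)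
    (hw : S w = l • T w) (hvw : T v = w) : v = 0 := by
  by_contra hv0
  -- Two values of S(Tv): one from S² = c, one from Tv lying in the eigenspace. Applying T and using
  -- T³ = c then gives Tv = l²v, so v spans a stable line.
  have h1 : (c / l) • v = l • T (T v) := by
    rw [← h.apply_S_T hl hv, hvw, hw]
  have h2 : T v = (l * l) • v := by
    have h3 := congrArg T h1
    rw [map_smul, map_smul, h.cube, smul_smul] at h3
    have h4 : (l * l / c) • (c / l) • T v = (l * l / c) • (l * c) • v := by rw [h3]
    rw [smul_smul, smul_smul] at h4
    have hc := h.ne_zero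
    rw [show l * l / c * (c / l) = l by field_simp,
      show l * l / c * (l * c) = l * (l * l) by field_simp, mul_smul l] at h4
    exact smul_right_injective V hl h4
  have h5 : T v ∈ Submodule.span K {v} := by
    rw [h2]; exact Submodule.smul_mem _ _ (Submodule.mem_span_singleton_self v)
  have h6 : S v ∈ Submodule.span K {v} := by
    rw [hv]; exact Submodule.smul_mem _ _ h5
  have := h.finrank_le_one hv0 h6 h5
  omega

theorem finrank_le_two_of_apply_T_T [FiniteDimensional K V] (h : IsSimplePair c S T)
    (hd : 1 < Module.finrank K V) (hl : l ≠ 0) {x w : V} {a : K} (hx0 : x ≠ 0)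
    (hx : S x = l • T x) (hw : S w = l • T w) (hT : T (T x) = w + a • T x) :
    Module.finrank K V ≤ 2 := by
  -- Expanding T³x = cx gives a relation between the eigenspace and its T-image; since these meet
  -- trivially, w = -a²x, and x, Tx span a stable plane.
  have h1 : T (w + (a * a) • x) = c • x - a • w := by
    have h2 := h.cube x
    rw [hT, map_add, map_smul, hT] at h2
    rw [map_add, map_smul, ← h2, smul_add, smul_smul]
    abel
  have h3 : w + (a * a) • x = 0 := by
    refine h.eq_zero_of_apply_T hd hl ?_ ?_ h1
    · simp only [map_add, map_smul, hw, hx]; module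
    · simp only [map_sub, map_smul, hw, hx]; module
  refine h.finrank_le_two hl hx0 hx ?_
  rw [Submodule.mem_span_pair]
  refine ⟨-(a * a), a, ?_⟩
  rw [hT, eq_neg_of_add_eq_zero_left h3, neg_smul]

variable [FiniteDimensional K V] [IsAlgClosed K]

/-- In dimension at most `5` the eigenspaces of `T⁻¹S` are lines. -/
theorem mem_span_singleton_of_eigenvector (h : IsSimplePair c S T)
    (hd : Module.finrank K V ≤ 5) (hl : l ≠ 0) {u v : V} (hu0 : u ≠ 0) (hu : S u = l • T u)
    (hv : S v = l • T v) : v ∈ Submodule.span K {u} := by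
  by_contra hvu
  set W : Submodule K V := LinearMap.ker (S - l • T) with hWdef
  have hW : ∀ x, x ∈ W ↔ S x = l • T x := fun x => by simp [hWdef, sub_eq_zero]
  have hli : LinearIndependent K ![u, v] := by
    rw [LinearIndependent.pair_iff' hu0]
    intro a ha
    exact hvu (ha ▸ Submodule.smul_mem _ _ (Submodule.mem_span_singleton_self u))
  have hW2 : 2 ≤ Module.finrank K W := by
    have hle : Submodule.span K (Set.range ![u, v]) ≤ W := by
      rw [Submodule.span_le]
      rintro _ ⟨i, rfl⟩
      fin_cases i
      · exact (hW u).2 hu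
      · exact (hW v).2 hv
    have h1 := finrank_span_eq_card hli
    have h2 := Submodule.finrank_mono hle
    rw [h1] at h2
    simpa using h2
  have hd1 : 1 < Module.finrank K V := lt_of_lt_of_le (by omega) (Submodule.finrank_le W)
  have hdisj : Disjoint W (W.map T) := by
    rw [Submodule.disjoint_def]
    rintro _ hx ⟨y, hy, rfl⟩
    rw [h.eq_zero_of_apply_T hd1 hl ((hW y).1 hy) ((hW _).1 hx) rfl, map_zero]
  have hmap : ∀ N : Submodule K V, Module.finrank K (N.map T) = Module.finrank K N := fun N =>
    (Submodule.equivMapOfInjective T h.injective_T N).finrank_eq.symm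
  have hU : Module.finrank K (W ⊔ W.map T : Submodule K V) = 2 * Module.finrank K W := by
    have h1 := Submodule.finrank_sup_add_finrank_inf_eq W (W.map T)
    rw [hdisj.eq_bot, finrank_bot, hmap] at h1
    omega
  have hUle := Submodule.finrank_le (W ⊔ W.map T)
  have hWeq : Module.finrank K W = 2 := by omega
  -- Dimensions 4 and 2 cannot be independent inside a space of dimension at most 5. This yields a
  -- relation T²x = w + Tz with x, w, z in W.
  have hne : (W ⊔ W.map T) ⊓ (W.map T).map T ≠ ⊥ := by
    intro h0
    have h1 := Submodule.finrank_sup_add_finrank_inf_eq (W ⊔ W.map T) ((W.map T).map T)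
    rw [h0, finrank_bot, hmap, hmap] at h1
    have h2 := Submodule.finrank_le ((W ⊔ W.map T) ⊔ (W.map T).map T)
    omega
  obtain ⟨y, ⟨hyU, x', ⟨x, hxW, rfl⟩, rfl⟩, hy0⟩ := Submodule.exists_mem_ne_zero_of_ne_bot hne
  obtain ⟨w, hw, y', ⟨z, hz, rfl⟩, hwz⟩ := Submodule.mem_sup.1 hyU
  have hx0 : x ≠ 0 := by rintro rfl; simp at hy0
  have hxS := (hW x).1 hxW
  have hwS := (hW w).1 hw
  have hzS := (hW z).1 hz
  have hdim : 2 < Module.finrank K V := by omega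
  by_cases hzx : z ∈ Submodule.span K {x}
  · obtain ⟨a, rfl⟩ := Submodule.mem_span_singleton.1 hzx
    have := h.finrank_le_two_of_apply_T_T hd1 hl hx0 hxS hwS (a := a) (by rw [← hwz, map_smul])
    omega
  · have hli : LinearIndependent K ![x, z] := by
      rw [LinearIndependent.pair_iff' hx0]
      intro a ha
      exact hzx (ha ▸ Submodule.smul_mem _ _ (Submodule.mem_span_singleton_self x))
    have hspan : Submodule.span K {x, z} = W := by
      refine Submodule.eq_of_le_of_finrank_eq ?_ ?_
      · rw [Submodule.span_le]
        rintro _ (rfl | rfl)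
        · exact hxW
        · exact hz
      · have h1 := finrank_span_eq_card hli
        rw [Matrix.range_cons, Matrix.range_cons, Matrix.range_empty, Set.union_empty,
          Set.singleton_union] at h1
        rw [h1, hWeq]
        simp
    rw [← hspan, Submodule.mem_span_pair] at hw
    obtain ⟨p, q, hpq⟩ := hw
    -- The root m is chosen so that w + mz = (q + m)(z - mx). Then x' = z - mx satisfies T²x' = (cx
    -- - mw) - (q + m)Tx', the relation already shown to force dimension at most 2.
    obtain ⟨m, hm⟩ := IsAlgClosed.exists_root (X ^ 2 + C q * X + C p : K[X]) (by
      rw [show (X ^ 2 + C q * X + C p : K[X]) = C 1 * X ^ 2 + C q * X + C p by simp,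
        degree_quadratic one_ne_zero]
      norm_num)
    simp only [IsRoot.def, eval_add, eval_pow, eval_X, eval_mul, eval_C] at hm
    have hTz : T (T z) = c • x - T w := by
      rw [← h.cube x, ← hwz, map_add]; abel
    have hx'0 : z - m • x ≠ 0 := by
      intro h0
      exact hzx (Submodule.mem_span_singleton.2 ⟨m, (sub_eq_zero.1 h0).symm⟩)
    have := h.finrank_le_two_of_apply_T_T hd1 hl hx'0 (x := z - m • x)
      (w := c • x - m • w) (a := -(q + m)) (by simp only [map_sub, map_smul, hzS, hxS]; module)
      (by simp only [map_sub, map_smul, hwS, hxS]; module) (by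
        have hp : p = -(q + m) * m := by linear_combination hm
        rw [map_sub, map_sub, map_smul, map_smul, hTz, ← hwz, ← hpq, hp]
        simp only [map_add, map_smul]
        module)
    omega

end IsSimplePair

end Pair

/-! ### Normal forms of simple pairs in dimensions 1 to 5 -/

section NormalForm

variable {K V : Type*} [Field K] [AddCommGroup V] [Module K V]

theorem toMatrix_eq_of_apply {ι : Type*} [Fintype ι] [DecidableEq ι] (b : Module.Basis ι K V)
    {f : Module.End K V} {M : Matrix ι ι K} (h : ∀ j, f (b j) = ∑ i, M i j • b i) :
    LinearMap.toMatrix b b f = M := by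
  rw [← LinearMap.toMatrix_toLin b b M]
  congr 1
  refine b.ext fun j => ?_
  rw [h j, Matrix.toLin_self]

theorem linearIndependent_vec3 {a b c : V} (hab : LinearIndependent K ![a, b])
    (hc : c ∉ Submodule.span K {a, b}) : LinearIndependent K ![a, b, c] := by
  rw [linearIndependent_finSucc']
  have h : Fin.init ![a, b, c] = ![a, b] := by ext i; fin_cases i <;> rfl
  rw [h]
  refine ⟨hab, ?_⟩
  rw [Matrix.range_cons, Matrix.range_cons, Matrix.range_empty, Set.union_empty]
  exact hc

theorem linearIndependent_vec4 {a b c d : V} (habc : LinearIndependent K ![a, b, c])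
    (hd : d ∉ Submodule.span K {a, b, c}) : LinearIndependent K ![a, b, c, d] := by
  rw [linearIndependent_finSucc']
  have h : Fin.init ![a, b, c, d] = ![a, b, c] := by ext i; fin_cases i <;> rfl
  rw [h]
  refine ⟨habc, ?_⟩
  rw [Matrix.range_cons, Matrix.range_cons, Matrix.range_cons, Matrix.range_empty, Set.union_empty]
  exact hd

theorem linearIndependent_vec5 {a b c d e : V} (habcd : LinearIndependent K ![a, b, c, d])
    (he : e ∉ Submodule.span K {a, b, c, d}) : LinearIndependent K ![a, b, c, d, e] := by
  rw [linearIndependent_finSucc']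
  have h : Fin.init ![a, b, c, d, e] = ![a, b, c, d] := by ext i; fin_cases i <;> rfl
  rw [h]
  refine ⟨habcd, ?_⟩
  rw [Matrix.range_cons, Matrix.range_cons, Matrix.range_cons, Matrix.range_cons,
    Matrix.range_empty, Set.union_empty]
  exact he

/-- The matrix of `σ₁σ₂` in a simple module of dimension `2`. -/
def pairT₂ (y : K) : Matrix (Fin 2) (Fin 2) K :=
  !![0, -y ^ 2; 1, y]

/-- The matrix of `σ₁σ₂σ₁` in a simple module of dimension `2`. -/
def pairS₂ (l y : K) : Matrix (Fin 2) (Fin 2) K :=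
  !![0, -y ^ 3 / l; l, 0]

/-- The matrix of `σ₁σ₂` in a simple module of dimension `3`. -/
def pairT₃ (D : K) : Matrix (Fin 3) (Fin 3) K :=
  !![0, 0, D ^ 2; 1, 0, 0; 0, 1, 0]

/-- The matrix of `σ₁σ₂σ₁` in a simple module of dimension `3`. -/
def pairS₃ (l D b : K) : Matrix (Fin 3) (Fin 3) K :=
  !![0, D ^ 2 / l, D * b; l, 0, l * b; 0, 0, -D]

/-- The matrix of `σ₁σ₂` in a simple module of dimension `4`. -/
def pairT₄ (g a b : K) : Matrix (Fin 4) (Fin 4) K :=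
  !![0, 0, -g ^ 3, g * a; 1, 0, 0, a + g * b; 0, 1, 0, b; 0, 0, 0, -g]

/-- The matrix of `σ₁σ₂σ₁` in a simple module of dimension `4`. -/
def pairS₄ (l g : K) : Matrix (Fin 4) (Fin 4) K :=
  !![0, -g ^ 3 / l, 0, 0; l, 0, 0, 0; 0, 0, 0, 1; 0, 0, -g ^ 3, 0]

/-- The matrix of `σ₁σ₂` in a simple module of dimension `5`. -/
def pairT₅ (g a : K) : Matrix (Fin 5) (Fin 5) K :=
  !![0, 0, g ^ 6, 0, g ^ 4 * a; 1, 0, 0, 0, g ^ 2 * a; 0, 1, 0, 0, a; 0, 0, 0, 0, -g ^ 4;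
    0, 0, 0, 1, -g ^ 2]

/-- The matrix of `σ₁σ₂σ₁` in a simple module of dimension `5`. -/
def pairS₅ (l g b e : K) : Matrix (Fin 5) (Fin 5) K :=
  !![0, g ^ 6 / l, 0, 0, -g ^ 3 * b; l, 0, 0, 0, l * b; 0, 0, 0, 1, e; 0, 0, g ^ 6, 0, -g ^ 3 * e;
    0, 0, 0, 0, g ^ 3]

/-- The factor x - l comes from the eigenvector e₀. The cofactor carries the free entries and is
later matched with the other eigenvalues; the same holds in the higher dimensions. -/
theorem det_pair₂ {l y : K} (hl : l ≠ 0) (x : K) :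
    (x • pairT₂ y - pairS₂ l y).det = y ^ 2 * ((x - l) * (x - y / l)) := by
  simp [pairT₂, pairS₂, Matrix.det_fin_two]
  field_simp
  ring

theorem det_pair₃ {l D : K} (b : K) (hl : l ≠ 0) (hD : D ≠ 0) (x : K) :
    (x • pairT₃ D - pairS₃ l D b).det =
      D ^ 2 * ((x - l) * (x ^ 2 - b / D * x + D / l)) := by
  simp [pairT₃, pairS₃, Matrix.det_fin_three]
  field_simp
  ring

theorem det_pair₄ {l g : K} (a b : K) (hl : l ≠ 0) (x : K) :
    (x • pairT₄ g a b - pairS₄ l g).det =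
      g ^ 4 * ((x - l) * (x ^ 3 - a * x ^ 2 + g ^ 2 * b / l * x - g ^ 2 / l)) := by
  simp [pairT₄, pairS₄, Matrix.det_succ_row_zero, Fin.sum_univ_succ, Fin.succAbove]
  field_simp
  ring

theorem det_pair₅ {l g : K} (a b e : K) (hl : l ≠ 0) (hg : g ≠ 0) (x : K) :
    (x • pairT₅ g a - pairS₅ l g b e).det =
      g ^ 10 * ((x - l) * (x ^ 4 - (a + e / g) * x ^ 3 - (b / g + a * g ^ 2 / l) * x ^ 2 +
        (e + g ^ 2) * g ^ 2 / l * x + g ^ 5 / l)) := by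
  simp [pairT₅, pairS₅, Matrix.det_succ_row_zero, Fin.sum_univ_succ, Fin.succAbove]
  field_simp
  ring

namespace IsSimplePair

variable {c l : K} {S T : Module.End K V}

theorem toMatrix_sq {ι : Type*} [Fintype ι] [DecidableEq ι] (h : IsSimplePair c S T)
    (b : Module.Basis ι K V) : LinearMap.toMatrix b b S * LinearMap.toMatrix b b S = c • 1 := by
  rw [← LinearMap.toMatrix_mul, ← LinearMap.toMatrix_one b, ← map_smul]
  congr 1
  ext v
  exact h.sq v

theorem toMatrix_cube {ι : Type*} [Fintype ι] [DecidableEq ι] (h : IsSimplePair c S T)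
    (b : Module.Basis ι K V) : LinearMap.toMatrix b b T *
      (LinearMap.toMatrix b b T * LinearMap.toMatrix b b T) = c • 1 := by
  rw [← LinearMap.toMatrix_mul, ← LinearMap.toMatrix_mul, ← LinearMap.toMatrix_one b, ← map_smul]
  congr 1
  ext v
  exact h.cube v

/-- On a line with T = t one has S = lt, and t³ = c = l²t² gives t = l². -/
theorem exists_basis₁ (h : IsSimplePair c S T) (hd : Module.finrank K V = 1) {u : V}
    (hu0 : u ≠ 0) (hu : S u = l • T u) :
    ∃ (B : Module.Basis (Fin 1) K V), c = l ^ 6 ∧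
      LinearMap.toMatrix B B S = !![l ^ 3] ∧ LinearMap.toMatrix B B T = !![l ^ 2] := by
  have hc := h.ne_zero
  obtain ⟨t, ht⟩ := (finrank_eq_one_iff_of_nonzero' u hu0).1 hd (T u)
  have h3 := h.cube u
  simp only [← ht, map_smul, smul_smul] at h3
  have h3 := smul_left_injective K hu0 h3
  have h2 := h.sq u
  simp only [hu, ← ht, map_smul, smul_smul] at h2
  have h2 := smul_left_injective K hu0 h2
  have ht0 : t ≠ 0 := by
    rintro rfl
    rw [mul_zero] at h3
    exact hc h3.symm
  have htl : t = l ^ 2 := by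
    have h4 : t * t * (t - l ^ 2) = 0 := by
      linear_combination h3 - h2
    rcases mul_eq_zero.1 h4 with h5 | h5
    · exact absurd h5 (mul_ne_zero ht0 ht0)
    · linear_combination h5
  have hli : LinearIndependent K ![u] := LinearIndependent.of_subsingleton (0 : Fin 1) hu0
  set B := basisOfLinearIndependentOfCardEqFinrank hli (by simp [hd]) with hB
  have hBi : ∀ i, B i = ![u] i := fun i => by
    rw [hB, basisOfLinearIndependentOfCardEqFinrank]
    simp
  have B0 : B 0 = u := hBi 0
  refine ⟨B, ?_, ?_, ?_⟩
  · rw [← h3, htl]; ring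
  · refine toMatrix_eq_of_apply B fun j => ?_
    fin_cases j
    simp [B0, hu, ← ht, htl, smul_smul]
    ring_nf
  · refine toMatrix_eq_of_apply B fun j => ?_
    fin_cases j
    simp [B0, ← ht, htl]

variable [FiniteDimensional K V]

/-- A dependence would make the span of the preceding vectors stable under S and T, and the
dimension would be too small. The next three lemmas use the same mechanism. -/
theorem linearIndependent₂ (h : IsSimplePair c S T) (hd : 2 ≤ Module.finrank K V) {u : V}
    (hu0 : u ≠ 0) (hu : S u = l • T u) : LinearIndependent K ![u, T u] := by
  rw [LinearIndependent.pair_iff' hu0]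
  intro a ha
  have h1 : T u ∈ Submodule.span K {u} := Submodule.mem_span_singleton.2 ⟨a, ha⟩
  have := h.finrank_le_one hu0 (hu ▸ Submodule.smul_mem _ _ h1) h1
  omega

theorem linearIndependent₃ (h : IsSimplePair c S T) (hd : 3 ≤ Module.finrank K V) (hl : l ≠ 0)
    {u : V} (hu0 : u ≠ 0) (hu : S u = l • T u) : LinearIndependent K ![u, T u, T (T u)] := by
  refine linearIndependent_vec3 (h.linearIndependent₂ (by omega) hu0 hu) fun h1 => ?_
  have := h.finrank_le_two hl hu0 hu h1
  omega

theorem linearIndependent₄ (h : IsSimplePair c S T) (hd : 4 ≤ Module.finrank K V) (hl : l ≠ 0)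
    {u w : V} (hu0 : u ≠ 0) (hu : S u = l • T u) (hw : S (T (T u)) = c • w) :
    LinearIndependent K ![u, T u, T (T u), w] := by
  classical
  refine linearIndependent_vec4 (h.linearIndependent₃ (by omega) hl hu0 hu) fun h1 => ?_
  have h2 : u ∈ Submodule.span K {u, T u, T (T u)} := Submodule.subset_span (by simp)
  have h3 : T u ∈ Submodule.span K {u, T u, T (T u)} := Submodule.subset_span (by simp)
  have h4 : T (T u) ∈ Submodule.span K {u, T u, T (T u)} := Submodule.subset_span (by simp)
  have := (h.finrank_le_card {u, T u, T (T u)} (by simp) hu0 (by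
    simp only [Finset.mem_insert, Finset.mem_singleton, forall_eq_or_imp, forall_eq,
      Finset.coe_insert, Finset.coe_singleton]
    rw [h.apply_S_T hl hu, hu, hw]
    exact ⟨Submodule.smul_mem _ _ h3, Submodule.smul_mem _ _ h2, Submodule.smul_mem _ _ h1⟩) (by
    simp only [Finset.mem_insert, Finset.mem_singleton, forall_eq_or_imp, forall_eq,
      Finset.coe_insert, Finset.coe_singleton]
    rw [h.cube]
    exact ⟨h3, h4, Submodule.smul_mem _ _ h2⟩)).trans Finset.card_le_three
  omega

theorem linearIndependent₅ (h : IsSimplePair c S T) (hd : 5 ≤ Module.finrank K V) (hl : l ≠ 0)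
    {u w : V} (hu0 : u ≠ 0) (hu : S u = l • T u) (hw : S (T (T u)) = c • w)
    (hw' : S w = T (T u)) : LinearIndependent K ![u, T u, T (T u), w, T w] := by
  classical
  refine linearIndependent_vec5 (h.linearIndependent₄ (by omega) hl hu0 hu hw) fun h1 => ?_
  have h2 : u ∈ Submodule.span K {u, T u, T (T u), w} := Submodule.subset_span (by simp)
  have h3 : T u ∈ Submodule.span K {u, T u, T (T u), w} := Submodule.subset_span (by simp)
  have h4 : T (T u) ∈ Submodule.span K {u, T u, T (T u), w} := Submodule.subset_span (by simp)
  have h5 : w ∈ Submodule.span K {u, T u, T (T u), w} := Submodule.subset_span (by simp)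
  have := (h.finrank_le_card {u, T u, T (T u), w} (by simp) hu0 (by
    simp only [Finset.mem_insert, Finset.mem_singleton, forall_eq_or_imp, forall_eq,
      Finset.coe_insert, Finset.coe_singleton]
    rw [h.apply_S_T hl hu, hu, hw, hw']
    exact ⟨Submodule.smul_mem _ _ h3, Submodule.smul_mem _ _ h2, Submodule.smul_mem _ _ h5, h4⟩) (by
    simp only [Finset.mem_insert, Finset.mem_singleton, forall_eq_or_imp, forall_eq,
      Finset.coe_insert, Finset.coe_singleton]
    rw [h.cube]
    exact ⟨h3, h4, Submodule.smul_mem _ _ h2, h1⟩)).trans Finset.card_le_four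
  omega

theorem exists_basis₅ (h : IsSimplePair c S T) (hd : Module.finrank K V = 5) (hl : l ≠ 0)
    {u : V} (hu0 : u ≠ 0) (hu : S u = l • T u) :
    ∃ (g a b e : K) (B : Module.Basis (Fin 5) K V), g ≠ 0 ∧ c = g ^ 6 ∧
      LinearMap.toMatrix B B S = pairS₅ l g b e ∧ LinearMap.toMatrix B B T = pairT₅ g a := by
  have hc := h.ne_zero
  set w : V := c⁻¹ • S (T (T u)) with hwdef
  have hw : S (T (T u)) = c • w := by rw [hwdef, smul_smul, mul_inv_cancel₀ hc, one_smul]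
  have hw' : S w = T (T u) := by
    rw [hwdef, map_smul, h.sq, smul_smul, inv_mul_cancel₀ hc, one_smul]
  have hli := h.linearIndependent₅ hd.ge hl hu0 hu hw hw'
  set B := basisOfLinearIndependentOfCardEqFinrank hli (by simp [hd]) with hB
  have hBi : ∀ i, B i = ![u, T u, T (T u), w, T w] i := fun i => by
    rw [hB, basisOfLinearIndependentOfCardEqFinrank]
    simp
  have B0 : B 0 = u := hBi 0
  have B1 : B 1 = T u := hBi 1
  have B2 : B 2 = T (T u) := hBi 2
  have B3 : B 3 = w := hBi 3
  have B4 : B 4 = T w := hBi 4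
  obtain ⟨x, hx⟩ : ∃ x : Fin 5 → K, ∑ i, x i • B i = T (T w) := ⟨_, B.sum_repr _⟩
  obtain ⟨z, hz⟩ : ∃ z : Fin 5 → K, ∑ i, z i • B i = S (T w) := ⟨_, B.sum_repr _⟩
  have hT : LinearMap.toMatrix B B T = !![0, 0, c, 0, x 0; 1, 0, 0, 0, x 1; 0, 1, 0, 0, x 2;
      0, 0, 0, 0, x 3; 0, 0, 0, 1, x 4] := by
    refine toMatrix_eq_of_apply B fun j => ?_
    fin_cases j
    · simp [Fin.sum_univ_succ, B0, B1]
    · simp [Fin.sum_univ_succ, B1, B2]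
    · simp [Fin.sum_univ_succ, B0, B2, h.cube]
    · simp [Fin.sum_univ_succ, B3, B4]
    · simp [Fin.sum_univ_succ, B4, ← hx]
  have hS : LinearMap.toMatrix B B S = !![0, c / l, 0, 0, z 0; l, 0, 0, 0, z 1; 0, 0, 0, 1, z 2;
      0, 0, c, 0, z 3; 0, 0, 0, 0, z 4] := by
    refine toMatrix_eq_of_apply B fun j => ?_
    fin_cases j
    · simp [Fin.sum_univ_succ, B0, B1, hu]
    · simp [Fin.sum_univ_succ, B0, B1, h.apply_S_T hl hu]
    · simp [Fin.sum_univ_succ, B3, B2, hw]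
    · simp [Fin.sum_univ_succ, B3, B2, hw']
    · simp [Fin.sum_univ_succ, B4, ← hz]
  have hS2 := h.toMatrix_sq B
  have hT3 := h.toMatrix_cube B
  rw [hS] at hS2
  rw [hT] at hT3
  have s0 := congrFun (congrFun hS2 0) 4
  have s1 := congrFun (congrFun hS2 1) 4
  have s2 := congrFun (congrFun hS2 2) 4
  have s3 := congrFun (congrFun hS2 3) 4
  have s4 := congrFun (congrFun hS2 4) 4
  have t0 := congrFun (congrFun hT3 0) 3
  have t1 := congrFun (congrFun hT3 1) 3
  have t2 := congrFun (congrFun hT3 2) 3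
  have t3 := congrFun (congrFun hT3 3) 3
  have t4 := congrFun (congrFun hT3 4) 3
  clear hS2 hT3
  simp [Matrix.mul_apply, Fin.sum_univ_succ] at s0 s1 s2 s3 s4 t0 t1 t2 t3 t4
  have hx4 : x 4 ≠ 0 := by
    rintro h0
    rw [h0, mul_zero] at t3
    exact hc t3.symm
  have hz4 : z 4 ≠ 0 := by
    rintro h0
    rw [h0, mul_zero] at s4
    exact hc s4.symm
  -- The entries `z 4` and `x 4` turn out to be g³ and -g², so g is minus their quotient: a sixth
  -- root of c is obtained without extracting a root.
  obtain ⟨g, hg⟩ : ∃ g, g = -(z 4 / x 4) := ⟨_, rfl⟩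
  have hg0 : g ≠ 0 := by rw [hg]; exact neg_ne_zero.2 (div_ne_zero hz4 hx4)
  have hzx : z 4 = -g * x 4 := by rw [hg]; field_simp
  have hxg : x 4 = -g ^ 2 := by
    have h1 : x 4 * x 4 * (x 4 + g ^ 2) = 0 := by
      rw [hzx] at s4
      linear_combination -t3 + x 4 * t4 + s4
    rcases mul_eq_zero.1 h1 with h2 | h2
    · exact absurd h2 (mul_ne_zero hx4 hx4)
    · linear_combination h2
  rw [hxg] at hzx t0 t1 t2 t3 t4
  have hzg : z 4 = g ^ 3 := by rw [hzx]; ring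
  rw [hzg] at s0 s1 s2 s3 s4
  have hcg : c = g ^ 6 := by rw [← s4]; ring
  refine ⟨g, x 2, z 1 / l, z 2, B, hg0, hcg, ?_, ?_⟩
  · rw [hS, pairS₅, hzg, hcg, eq_neg_of_add_eq_zero_left s2,
      show l * (z 1 / l) = z 1 by field_simp,
      show z 0 = -g ^ 3 * (z 1 / l) by field_simp; linear_combination s1,
      show -(z 2 * g ^ 3) = -g ^ 3 * z 2 by ring]
  · rw [hT, pairT₅, hxg, hcg, show x 1 = g ^ 2 * x 2 by linear_combination t2,
      show x 0 = g ^ 4 * x 2 by linear_combination t1 + g ^ 2 * t2,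
      show x 3 = -g ^ 4 by linear_combination t4]

/-- S exchanges the lines of u and Tu and those of T²u and w, so S² = c imposes nothing more. On the
quotient by u, Tu, T²u the operator T is a cube root of c, and g is its negative. -/
theorem exists_basis₄ (h : IsSimplePair c S T) (hd : Module.finrank K V = 4) (hl : l ≠ 0)
    {u : V} (hu0 : u ≠ 0) (hu : S u = l • T u) :
    ∃ (g a b : K) (B : Module.Basis (Fin 4) K V), g ≠ 0 ∧ c = -g ^ 3 ∧
      LinearMap.toMatrix B B S = pairS₄ l g ∧ LinearMap.toMatrix B B T = pairT₄ g a b := by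
  have hc := h.ne_zero
  set w : V := c⁻¹ • S (T (T u)) with hwdef
  have hw : S (T (T u)) = c • w := by rw [hwdef, smul_smul, mul_inv_cancel₀ hc, one_smul]
  have hw' : S w = T (T u) := by
    rw [hwdef, map_smul, h.sq, smul_smul, inv_mul_cancel₀ hc, one_smul]
  have hli := h.linearIndependent₄ hd.ge hl hu0 hu hw
  set B := basisOfLinearIndependentOfCardEqFinrank hli (by simp [hd]) with hB
  have hBi : ∀ i, B i = ![u, T u, T (T u), w] i := fun i => by
    rw [hB, basisOfLinearIndependentOfCardEqFinrank]
    simp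
  have B0 : B 0 = u := hBi 0
  have B1 : B 1 = T u := hBi 1
  have B2 : B 2 = T (T u) := hBi 2
  have B3 : B 3 = w := hBi 3
  obtain ⟨x, hx⟩ : ∃ x : Fin 4 → K, ∑ i, x i • B i = T w := ⟨_, B.sum_repr _⟩
  have hT : LinearMap.toMatrix B B T = !![0, 0, c, x 0; 1, 0, 0, x 1; 0, 1, 0, x 2;
      0, 0, 0, x 3] := by
    refine toMatrix_eq_of_apply B fun j => ?_
    fin_cases j
    · simp [Fin.sum_univ_succ, B0, B1]
    · simp [Fin.sum_univ_succ, B1, B2]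
    · simp [Fin.sum_univ_succ, B0, B2, h.cube]
    · simp [Fin.sum_univ_succ, B3, ← hx]
  have hS : LinearMap.toMatrix B B S = !![0, c / l, 0, 0; l, 0, 0, 0; 0, 0, 0, 1;
      0, 0, c, 0] := by
    refine toMatrix_eq_of_apply B fun j => ?_
    fin_cases j
    · simp [Fin.sum_univ_succ, B0, B1, hu]
    · simp [Fin.sum_univ_succ, B0, B1, h.apply_S_T hl hu]
    · simp [Fin.sum_univ_succ, B3, B2, hw]
    · simp [Fin.sum_univ_succ, B3, B2, hw']
  have hT3 := h.toMatrix_cube B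
  rw [hT] at hT3
  have t2 := congrFun (congrFun hT3 2) 3
  have t3 := congrFun (congrFun hT3 3) 3
  clear hT3
  simp [Matrix.mul_apply, Fin.sum_univ_succ] at t2 t3
  have hx3 : x 3 ≠ 0 := by
    rintro h0
    rw [h0, mul_zero, mul_zero] at t3
    exact hc t3.symm
  have hcg : c = -(-x 3) ^ 3 := by rw [← t3]; ring
  refine ⟨-x 3, x 1 + x 3 * x 2, x 2, B, neg_ne_zero.2 hx3, hcg, ?_, ?_⟩
  · rw [hS, pairS₄, ← hcg]
  · rw [hT, pairT₄, ← hcg, show x 1 + x 3 * x 2 + -x 3 * x 2 = x 1 by ring, neg_neg,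
      show -x 3 * (x 1 + x 3 * x 2) = x 0 by linear_combination -t2]

/-- On the quotient by u, Tu the operator S is a square root of c. Its negative is D, a sign that
makes D the product of the eigenvalues. -/
theorem exists_basis₃ (h : IsSimplePair c S T) (hd : Module.finrank K V = 3) (hl : l ≠ 0)
    {u : V} (hu0 : u ≠ 0) (hu : S u = l • T u) :
    ∃ (D b : K) (B : Module.Basis (Fin 3) K V), D ≠ 0 ∧ c = D ^ 2 ∧
      LinearMap.toMatrix B B S = pairS₃ l D b ∧ LinearMap.toMatrix B B T = pairT₃ D := by
  have hc := h.ne_zero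
  have hli := h.linearIndependent₃ hd.ge hl hu0 hu
  set B := basisOfLinearIndependentOfCardEqFinrank hli (by simp [hd]) with hB
  have hBi : ∀ i, B i = ![u, T u, T (T u)] i := fun i => by
    rw [hB, basisOfLinearIndependentOfCardEqFinrank]
    simp
  have B0 : B 0 = u := hBi 0
  have B1 : B 1 = T u := hBi 1
  have B2 : B 2 = T (T u) := hBi 2
  obtain ⟨z, hz⟩ : ∃ z : Fin 3 → K, ∑ i, z i • B i = S (T (T u)) := ⟨_, B.sum_repr _⟩
  have hT : LinearMap.toMatrix B B T = !![0, 0, c; 1, 0, 0; 0, 1, 0] := by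
    refine toMatrix_eq_of_apply B fun j => ?_
    fin_cases j
    · simp [Fin.sum_univ_succ, B0, B1]
    · simp [Fin.sum_univ_succ, B1, B2]
    · simp [Fin.sum_univ_succ, B0, B2, h.cube]
  have hS : LinearMap.toMatrix B B S = !![0, c / l, z 0; l, 0, z 1; 0, 0, z 2] := by
    refine toMatrix_eq_of_apply B fun j => ?_
    fin_cases j
    · simp [Fin.sum_univ_succ, B0, B1, hu]
    · simp [Fin.sum_univ_succ, B0, B1, h.apply_S_T hl hu]
    · simp [Fin.sum_univ_succ, B2, ← hz]
  have hS2 := h.toMatrix_sq B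
  rw [hS] at hS2
  have s1 := congrFun (congrFun hS2 1) 2
  have s2 := congrFun (congrFun hS2 2) 2
  clear hS2
  simp [Matrix.mul_apply, Fin.sum_univ_succ] at s1 s2
  have hz2 : z 2 ≠ 0 := by
    rintro h0
    rw [h0, mul_zero] at s2
    exact hc s2.symm
  have hcD : c = (-z 2) ^ 2 := by rw [← s2]; ring
  refine ⟨-z 2, z 1 / l, B, neg_ne_zero.2 hz2, hcD, ?_, ?_⟩
  · rw [hS, pairS₃, ← hcD, neg_neg, show l * (z 1 / l) = z 1 by field_simp,
      show -z 2 * (z 1 / l) = z 0 by field_simp; linear_combination -s1]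
  · rw [hT, pairT₃, ← hcD]

/-- T is a companion matrix with trace y, and the vanishing of an off-diagonal entry of T³ forces
its determinant to be y². -/
theorem exists_basis₂ (h : IsSimplePair c S T) (hd : Module.finrank K V = 2) (hl : l ≠ 0)
    {u : V} (hu0 : u ≠ 0) (hu : S u = l • T u) :
    ∃ (y : K) (B : Module.Basis (Fin 2) K V), y ≠ 0 ∧ c = -y ^ 3 ∧
      LinearMap.toMatrix B B S = pairS₂ l y ∧ LinearMap.toMatrix B B T = pairT₂ y := by
  have hc := h.ne_zero
  have hli := h.linearIndependent₂ hd.ge hu0 hu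
  set B := basisOfLinearIndependentOfCardEqFinrank hli (by simp [hd]) with hB
  have hBi : ∀ i, B i = ![u, T u] i := fun i => by
    rw [hB, basisOfLinearIndependentOfCardEqFinrank]
    simp
  have B0 : B 0 = u := hBi 0
  have B1 : B 1 = T u := hBi 1
  obtain ⟨x, hx⟩ : ∃ x : Fin 2 → K, ∑ i, x i • B i = T (T u) := ⟨_, B.sum_repr _⟩
  have hT : LinearMap.toMatrix B B T = !![0, x 0; 1, x 1] := by
    refine toMatrix_eq_of_apply B fun j => ?_
    fin_cases j
    · simp [Fin.sum_univ_succ, B0, B1]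
    · simp [Fin.sum_univ_succ, B1, ← hx]
  have hS : LinearMap.toMatrix B B S = !![0, c / l; l, 0] := by
    refine toMatrix_eq_of_apply B fun j => ?_
    fin_cases j
    · simp [Fin.sum_univ_succ, B0, B1, hu]
    · simp [Fin.sum_univ_succ, B0, B1, h.apply_S_T hl hu]
  have hT3 := h.toMatrix_cube B
  rw [hT] at hT3
  have t0 := congrFun (congrFun hT3 0) 0
  have t1 := congrFun (congrFun hT3 1) 0
  clear hT3
  simp [Matrix.mul_apply, Fin.sum_univ_succ] at t0 t1
  have hx1 : x 1 ≠ 0 := by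
    rintro h0
    rw [h0, mul_zero] at t0
    exact hc t0.symm
  have hx0 : x 0 = -x 1 ^ 2 := by linear_combination t1
  have hcy : c = -x 1 ^ 3 := by rw [← t0, hx0]; ring
  refine ⟨x 1, B, hx1, hcy, ?_, ?_⟩
  · rw [hS, pairS₂, hcy]
  · rw [hT, pairT₂, hx0]

end IsSimplePair

end NormalForm

/-! ### Explicit matrices attached to a parameter -/

section Model

variable {K : Type*} [Field K]

/-- The matrix of `σ₂` for `pairS₂`, `pairT₂`. -/
def pairB₂ (l y : K) : Matrix (Fin 2) (Fin 2) K :=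
  !![y / l, 0; l / y, l]

/-- The matrix of `σ₂` for `pairS₃`, `pairT₃`. -/
def pairB₃ (l D b : K) : Matrix (Fin 3) (Fin 3) K :=
  !![b / D, 0, D ^ 2 / l; l * b / D ^ 2, l, 0; -D⁻¹, 0, 0]

/-- The matrix of `σ₂` for `pairS₄`, `pairT₄`. -/
def pairB₄ (l g a b : K) : Matrix (Fin 4) (Fin 4) K :=
  !![0, 0, -g ^ 3 / l, -(g ^ 2 * b / l); 0, l, 0, l * b + l * a / g; 0, 0, 0, -g⁻¹; 1, 0, 0, a]

/-- The matrix of `σ₂` for `pairS₅`, `pairT₅`. -/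
def pairB₅ (l g a b e : K) : Matrix (Fin 5) (Fin 5) K :=
  !![0, 0, g ^ 6 / l, b / g + a * g ^ 2 / l, 0; 0, l, 0, (a * g ^ 2 - b) * l / g ^ 4, 0;
    0, 0, 0, -(e + g ^ 2) / g ^ 4, 1; 1, 0, 0, a + e / g, 0; 0, 0, 0, -g⁻¹, 0]

theorem pairS₂_sq {l : K} (y : K) (hl : l ≠ 0) : pairS₂ l y * pairS₂ l y = (-y ^ 3) • 1 := by
  ext i j
  fin_cases i <;> fin_cases j <;> simp [pairS₂, Matrix.mul_apply, Fin.sum_univ_succ] <;>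
    field_simp

theorem pairT₂_cube (y : K) : pairT₂ y * (pairT₂ y * pairT₂ y) = (-y ^ 3) • 1 := by
  ext i j
  fin_cases i <;> fin_cases j <;>
    simp [pairT₂, Matrix.mul_apply, Fin.sum_univ_succ] <;>
    first | ring1 | exact Or.inr (by ring)

theorem pairB₂_mul {l y : K} (hl : l ≠ 0) (hy : y ≠ 0) : pairB₂ l y * pairT₂ y = pairS₂ l y := by
  ext i j
  fin_cases i <;> fin_cases j <;>
    simp [pairB₂, pairT₂, pairS₂, Matrix.mul_apply, Fin.sum_univ_succ] <;> field_simp <;> ring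

theorem pairS₃_sq {l : K} (D b : K) (hl : l ≠ 0) :
    pairS₃ l D b * pairS₃ l D b = (D ^ 2) • 1 := by
  ext i j
  fin_cases i <;> fin_cases j <;>
    simp [pairS₃, Matrix.mul_apply, Fin.sum_univ_succ] <;> field_simp <;> ring

theorem pairT₃_cube (D : K) : pairT₃ D * (pairT₃ D * pairT₃ D) = (D ^ 2) • 1 := by
  ext i j
  fin_cases i <;> fin_cases j <;> simp [pairT₃, Matrix.mul_apply, Fin.sum_univ_succ]

theorem pairB₃_mul {l D : K} (b : K) (hl : l ≠ 0) (hD : D ≠ 0) :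
    pairB₃ l D b * pairT₃ D = pairS₃ l D b := by
  ext i j
  fin_cases i <;> fin_cases j <;>
    simp [pairB₃, pairT₃, pairS₃, Matrix.mul_apply, Fin.sum_univ_succ] <;> field_simp

theorem pairS₄_sq {l : K} (g : K) (hl : l ≠ 0) : pairS₄ l g * pairS₄ l g = (-g ^ 3) • 1 := by
  ext i j
  fin_cases i <;> fin_cases j <;>
    simp [pairS₄, Matrix.mul_apply, Fin.sum_univ_succ] <;> field_simp

theorem pairT₄_cube (g a b : K) :
    pairT₄ g a b * (pairT₄ g a b * pairT₄ g a b) = (-g ^ 3) • 1 := by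
  ext i j
  fin_cases i <;> fin_cases j <;>
    simp [pairT₄, Matrix.mul_apply, Fin.sum_univ_succ] <;> ring

theorem pairB₄_mul {l g : K} (a b : K) (hl : l ≠ 0) (hg : g ≠ 0) :
    pairB₄ l g a b * pairT₄ g a b = pairS₄ l g := by
  ext i j
  fin_cases i <;> fin_cases j <;>
    simp [pairB₄, pairT₄, pairS₄, Matrix.mul_apply, Fin.sum_univ_succ] <;> field_simp <;> ring

theorem pairS₅_sq {l : K} (g b e : K) (hl : l ≠ 0) :
    pairS₅ l g b e * pairS₅ l g b e = (g ^ 6) • 1 := by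
  ext i j
  fin_cases i <;> fin_cases j <;>
    simp [pairS₅, Matrix.mul_apply, Fin.sum_univ_succ] <;> field_simp <;> ring

theorem pairT₅_cube (g a : K) :
    pairT₅ g a * (pairT₅ g a * pairT₅ g a) = (g ^ 6) • 1 := by
  ext i j
  fin_cases i <;> fin_cases j <;>
    simp [pairT₅, Matrix.mul_apply, Fin.sum_univ_succ] <;>
    first | ring1 | exact Or.inr (by ring)

theorem pairB₅_mul {l g : K} (a b e : K) (hl : l ≠ 0) (hg : g ≠ 0) :
    pairB₅ l g a b e * pairT₅ g a = pairS₅ l g b e := by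
  ext i j
  fin_cases i <;> fin_cases j <;>
    simp [pairB₅, pairT₅, pairS₅, Matrix.mul_apply, Fin.sum_univ_succ] <;> field_simp <;> ring

theorem det_pairT₂ (y : K) : (pairT₂ y).det = y ^ 2 := by
  simp [pairT₂]

theorem det_pairT₃ (D : K) : (pairT₃ D).det = D ^ 2 := by
  simp [pairT₃, Matrix.det_fin_three]

theorem det_pairT₄ (g a b : K) : (pairT₄ g a b).det = g ^ 4 := by
  simp [pairT₄, Matrix.det_succ_row_zero, Fin.sum_univ_succ, Fin.succAbove]
  ring

theorem det_pairT₅ (g a : K) : (pairT₅ g a).det = g ^ 10 := by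
  simp [pairT₅, Matrix.det_succ_row_zero, Fin.sum_univ_succ, Fin.succAbove]
  ring

/-- The entry `e` of `pairS₅` in terms of the parameter. -/
def entryE₅ (l : Fin 5 → K) (g : K) : K :=
  -(l 1 * l 2 * l 3 + l 1 * l 2 * l 4 + l 1 * l 3 * l 4 + l 2 * l 3 * l 4) * l 0 / g ^ 2 - g ^ 2

/-- The entry `a` of `pairT₅` in terms of the parameter. -/
def entryA₅ (l : Fin 5 → K) (g : K) : K :=
  l 1 + l 2 + l 3 + l 4 - entryE₅ l g / g

/-- The entry `b` of `pairS₅` in terms of the parameter. -/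
def entryB₅ (l : Fin 5 → K) (g : K) : K :=
  -(l 1 * l 2 + l 1 * l 3 + l 1 * l 4 + l 2 * l 3 + l 2 * l 4 + l 3 * l 4) * g -
    entryA₅ l g * g ^ 3 / l 0

/-- The entry `b` of `pairT₄` in terms of the parameter. -/
def entryB₄ (l : Fin 4 → K) (g : K) : K :=
  l 0 * (l 1 * l 2 + l 1 * l 3 + l 2 * l 3) / g ^ 2

/-- The scalar by which `ζ` acts in the model with a given parameter. -/
def modelC : {d : ℕ} → Param K d → K
  | 1, (l, _) => l 0 ^ 6
  | 2, (l, _) => -(l 0 * l 1) ^ 3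
  | 3, (l, _) => (l 0 * l 1 * l 2) ^ 2
  | 4, (_, g) => -g ^ 3
  | 5, (_, g) => g ^ 6
  | _, _ => 1

/-- The matrix of `σ₁σ₂σ₁` in the model with a given parameter. -/
def modelS : {d : ℕ} → Param K d → Matrix (Fin d) (Fin d) K
  | 1, (l, _) => !![l 0 ^ 3]
  | 2, (l, _) => pairS₂ (l 0) (l 0 * l 1)
  | 3, (l, _) => pairS₃ (l 0) (l 0 * l 1 * l 2) (l 0 * l 1 * l 2 * (l 1 + l 2))
  | 4, (l, g) => pairS₄ (l 0) g
  | 5, (l, g) => pairS₅ (l 0) g (entryB₅ l g) (entryE₅ l g)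
  | _, _ => 1

/-- The matrix of `σ₁σ₂` in the model with a given parameter. -/
def modelT : {d : ℕ} → Param K d → Matrix (Fin d) (Fin d) K
  | 1, (l, _) => !![l 0 ^ 2]
  | 2, (l, _) => pairT₂ (l 0 * l 1)
  | 3, (l, _) => pairT₃ (l 0 * l 1 * l 2)
  | 4, (l, g) => pairT₄ g (l 1 + l 2 + l 3) (entryB₄ l g)
  | 5, (l, g) => pairT₅ g (entryA₅ l g)
  | _, _ => 1

/-- The matrix of `σ₂` in the model with a given parameter. -/
def modelB : {d : ℕ} → Param K d → Matrix (Fin d) (Fin d) K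
  | 1, (l, _) => !![l 0]
  | 2, (l, _) => pairB₂ (l 0) (l 0 * l 1)
  | 3, (l, _) => pairB₃ (l 0) (l 0 * l 1 * l 2) (l 0 * l 1 * l 2 * (l 1 + l 2))
  | 4, (l, g) => pairB₄ (l 0) g (l 1 + l 2 + l 3) (entryB₄ l g)
  | 5, (l, g) => pairB₅ (l 0) g (entryA₅ l g) (entryB₅ l g) (entryE₅ l g)
  | _, _ => 1

theorem snd_ne_zero_of_four {p : Param K 4} (hp : p ∈ paramSpace K 4) : p.2 ≠ 0 := by
  obtain ⟨h1, h2⟩ := hp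
  change p.2 ^ 2 = _ at h2
  intro h0
  rw [h0, zero_pow two_ne_zero] at h2
  exact Finset.prod_ne_zero_iff.2 (fun i _ => h1 i) h2.symm

theorem snd_ne_zero_of_five {p : Param K 5} (hp : p ∈ paramSpace K 5) : p.2 ≠ 0 := by
  obtain ⟨h1, h2⟩ := hp
  change p.2 ^ 5 = _ at h2
  intro h0
  rw [h0, zero_pow (by norm_num)] at h2
  exact Finset.prod_ne_zero_iff.2 (fun i _ => h1 i) h2.symm

theorem modelC_ne_zero {d : ℕ} {p : Param K d} (hp : p ∈ paramSpace K d) : modelC p ≠ 0 := by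
  match d, p, hp with
  | 0, _, _ => exact one_ne_zero
  | 1, (l, g), hp => exact pow_ne_zero _ (hp.1 0)
  | 2, (l, g), hp => exact neg_ne_zero.2 (pow_ne_zero _ (mul_ne_zero (hp.1 0) (hp.1 1)))
  | 3, (l, g), hp =>
    exact pow_ne_zero _ (mul_ne_zero (mul_ne_zero (hp.1 0) (hp.1 1)) (hp.1 2))
  | 4, (l, g), hp => exact neg_ne_zero.2 (pow_ne_zero _ (snd_ne_zero_of_four hp))
  | 5, (l, g), hp => exact pow_ne_zero _ (snd_ne_zero_of_five hp)
  | _ + 6, _, _ => exact one_ne_zero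

theorem modelS_sq {d : ℕ} {p : Param K d} (hp : p ∈ paramSpace K d) :
    modelS p * modelS p = modelC p • 1 := by
  match d, p, hp with
  | 0, _, _ => exact Subsingleton.elim _ _
  | 1, (l, g), hp =>
    ext i j
    fin_cases i; fin_cases j
    simp [modelS, modelC]
    ring
  | 2, (l, g), hp => exact pairS₂_sq _ (hp.1 0)
  | 3, (l, g), hp => exact pairS₃_sq _ _ (hp.1 0)
  | 4, (l, g), hp => exact pairS₄_sq _ (hp.1 0)
  | 5, (l, g), hp => exact pairS₅_sq _ _ _ (hp.1 0)
  | _ + 6, _, _ => simp [modelS, modelC]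

theorem modelT_cube {d : ℕ} (p : Param K d) :
    modelT p * (modelT p * modelT p) = modelC p • 1 := by
  match d, p with
  | 0, _ => exact Subsingleton.elim _ _
  | 1, (l, g) =>
    ext i j
    fin_cases i; fin_cases j
    simp [modelT, modelC]
    ring
  | 2, (l, g) => exact pairT₂_cube _
  | 3, (l, g) => exact pairT₃_cube _
  | 4, (l, g) => exact pairT₄_cube _ _ _
  | 5, (l, g) => exact pairT₅_cube _ _
  | _ + 6, _ => simp [modelT, modelC]

theorem modelB_mul {d : ℕ} {p : Param K d} (hp : p ∈ paramSpace K d) :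
    modelB p * modelT p = modelS p := by
  match d, p, hp with
  | 0, _, _ => exact Subsingleton.elim _ _
  | 1, (l, g), hp =>
    ext i j
    fin_cases i; fin_cases j
    simp [modelS, modelT, modelB]
    ring
  | 2, (l, g), hp => exact pairB₂_mul (hp.1 0) (mul_ne_zero (hp.1 0) (hp.1 1))
  | 3, (l, g), hp =>
    exact pairB₃_mul _ (hp.1 0) (mul_ne_zero (mul_ne_zero (hp.1 0) (hp.1 1)) (hp.1 2))
  | 4, (l, g), hp => exact pairB₄_mul _ _ (hp.1 0) (snd_ne_zero_of_four hp)
  | 5, (l, g), hp => exact pairB₅_mul _ _ _ (hp.1 0) (snd_ne_zero_of_five hp)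
  | _ + 6, _, _ => simp [modelS, modelT, modelB]

/-- The entries of the model are chosen so that the cofactor of x - λ₀ is the product of x - λᵢ over
the other i. For d = 4 and d = 5 this uses the root relation to identify the constant term. -/
theorem det_model {d : ℕ} (hd1 : 1 ≤ d) (hd5 : d ≤ 5) {p : Param K d} (hp : p ∈ paramSpace K d)
    (x : K) : (x • modelT p - modelS p).det = (modelT p).det * ∏ i, (x - p.1 i) := by
  match d, p, hp with
  | 1, (l, g), hp =>
    simp [modelT, modelS]
    ring
  | 2, (l, g), hp =>
    have h0 := hp.1 0
    simp only [modelS, modelT, det_pair₂ h0, det_pairT₂, Fin.prod_univ_two] at h0 ⊢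
    field_simp
  | 3, (l, g), hp =>
    have h0 := hp.1 0
    have h1 := hp.1 1
    have h2 := hp.1 2
    simp only [modelS, modelT, det_pairT₃, Fin.prod_univ_three] at h0 h1 h2 ⊢
    rw [det_pair₃ _ h0 (mul_ne_zero (mul_ne_zero h0 h1) h2)]
    field_simp
    ring
  | 4, (l, g), hp =>
    have h0 := hp.1 0
    have hg := snd_ne_zero_of_four hp
    have hr : g ^ 2 = _ := hp.2
    rw [Fin.prod_univ_four] at hr
    simp only [modelS, modelT, det_pairT₄, Fin.prod_univ_four, det_pair₄ _ _ h0, entryB₄] at h0 hg ⊢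
    congr 1
    rw [show g ^ 2 * (l 0 * (l 1 * l 2 + l 1 * l 3 + l 2 * l 3) / g ^ 2) / l 0 =
        l 1 * l 2 + l 1 * l 3 + l 2 * l 3 by field_simp,
      show g ^ 2 / l 0 = l 1 * l 2 * l 3 by rw [hr]; field_simp]
    ring
  | 5, (l, g), hp =>
    have h0 := hp.1 0
    have hg := snd_ne_zero_of_five hp
    have hr : g ^ 5 = _ := hp.2
    rw [Fin.prod_univ_five] at hr
    simp only [modelS, modelT, det_pairT₅, Fin.prod_univ_five, det_pair₅ _ _ _ h0 hg] at h0 hg ⊢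
    congr 1
    rw [show g ^ 5 / l 0 = l 1 * l 2 * l 3 * l 4 by rw [hr]; field_simp,
      show entryB₅ l g / g + entryA₅ l g * g ^ 2 / l 0 =
        -(l 1 * l 2 + l 1 * l 3 + l 1 * l 4 + l 2 * l 3 + l 2 * l 4 + l 3 * l 4) by
          rw [entryB₅]; field_simp; ring,
      show entryA₅ l g + entryE₅ l g / g = l 1 + l 2 + l 3 + l 4 by rw [entryA₅]; ring,
      show (entryE₅ l g + g ^ 2) * g ^ 2 / l 0 =
        -(l 1 * l 2 * l 3 + l 1 * l 2 * l 4 + l 1 * l 3 * l 4 + l 2 * l 3 * l 4) by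
          rw [entryE₅]; field_simp; ring]
    ring

/-- Over an infinite field the factor x - l cancels as a polynomial. Cofactors of lower degree are
padded with zero coefficients. -/
theorem coeff_eq_zero_of_forall_mul_eq_zero [Infinite K] {l k₀ k₁ k₂ k₃ : K}
    (h : ∀ x : K, (x - l) * (k₃ * x ^ 3 + k₂ * x ^ 2 + k₁ * x + k₀) = 0) :
    k₀ = 0 ∧ k₁ = 0 ∧ k₂ = 0 ∧ k₃ = 0 := by
  have h1 : (X - C l) * (C k₃ * X ^ 3 + C k₂ * X ^ 2 + C k₁ * X + C k₀) = 0 :=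
    Polynomial.funext fun x => by simpa using h x
  have h2 := (mul_eq_zero.1 h1).resolve_left (X_sub_C_ne_zero l)
  refine ⟨?_, ?_, ?_, ?_⟩
  · simpa [coeff_X, coeff_C] using congrArg (fun q => coeff q 0) h2
  · simpa [coeff_X, coeff_C] using congrArg (fun q => coeff q 1) h2
  · simpa [coeff_X, coeff_C] using congrArg (fun q => coeff q 2) h2
  · simpa [coeff_X, coeff_C] using congrArg (fun q => coeff q 3) h2

/-- Only an eigenvector for `l 0` enters the basis. Equating the coefficients of the cofactors then
solves for the free entries and yields the root relation for g. -/
theorem IsSimplePair.exists_model_basis [Infinite K] {V : Type*} [AddCommGroup V] [Module K V]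
    [FiniteDimensional K V] {c : K} {S T : Module.End K V} (h : IsSimplePair c S T) {d : ℕ}
    (hd1 : 1 ≤ d) (hd5 : d ≤ 5) (hd : Module.finrank K V = d) (l : Fin d → K)
    (hdet : ∀ x : K, LinearMap.det (x • T - S) = LinearMap.det T * ∏ i, (x - l i)) :
    ∃ g : K, (l, g) ∈ paramSpace K d ∧ c = modelC (l, g) ∧ ∃ B : Module.Basis (Fin d) K V,
      LinearMap.toMatrix B B S = modelS (l, g) ∧ LinearMap.toMatrix B B T = modelT (l, g) := by
  -- At x = 0 the determinant is that of -S, and S is injective.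
  have hl : ∀ i, l i ≠ 0 := by
    intro i hi
    have h1 := hdet 0
    rw [Finset.prod_eq_zero (Finset.mem_univ i) (by rw [hi, sub_zero]), mul_zero] at h1
    obtain ⟨v, hv, hv0⟩ := Submodule.exists_mem_ne_zero_of_ne_bot
      (LinearMap.bot_lt_ker_of_det_eq_zero h1).ne'
    rw [LinearMap.mem_ker, zero_smul, zero_sub, LinearMap.neg_apply, neg_eq_zero] at hv
    exact hv0 (h.injective_S (by rw [hv, map_zero]))
  have hu : ∀ i, ∃ u : V, u ≠ 0 ∧ S u = l i • T u := by
    intro i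
    have h1 := hdet (l i)
    rw [Finset.prod_eq_zero (Finset.mem_univ i) (sub_self _), mul_zero] at h1
    obtain ⟨v, hv, hv0⟩ := Submodule.exists_mem_ne_zero_of_ne_bot
      (LinearMap.bot_lt_ker_of_det_eq_zero h1).ne'
    rw [LinearMap.mem_ker, LinearMap.sub_apply, LinearMap.smul_apply, sub_eq_zero] at hv
    exact ⟨v, hv0, hv.symm⟩
  have hdet' : ∀ (B : Module.Basis (Fin d) K V) (x : K),
      (x • LinearMap.toMatrix B B T - LinearMap.toMatrix B B S).det =
        (LinearMap.toMatrix B B T).det * ∏ i, (x - l i) := by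
    intro B x
    rw [← map_smul, ← map_sub, LinearMap.det_toMatrix, LinearMap.det_toMatrix, hdet]
  match d, hd1, hd5 with
  | 1, _, _ =>
    obtain ⟨u, hu0, hu⟩ := hu 0
    obtain ⟨B, hc, hS, hT⟩ := h.exists_basis₁ hd hu0 hu
    exact ⟨1, ⟨hl, rfl⟩, hc, B, hS, hT⟩
  | 2, _, _ =>
    obtain ⟨u, hu0, hu⟩ := hu 0
    obtain ⟨y, B, hy, hc, hS, hT⟩ := h.exists_basis₂ hd (hl 0) hu0 hu
    have h0 := hl 0
    have hdet := hdet' B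
    simp only [hS, hT, det_pair₂ h0, det_pairT₂, Fin.prod_univ_two] at hdet
    obtain ⟨k0, -⟩ := coeff_eq_zero_of_forall_mul_eq_zero (l := l 0) (k₀ := l 1 - y / l 0)
      (k₁ := 0) (k₂ := 0) (k₃ := 0) fun x => by
        linear_combination mul_left_cancel₀ (pow_ne_zero 2 hy) (hdet x)
    have hy' : y = l 0 * l 1 := by
      field_simp at k0
      linear_combination -k0
    subst hy'
    exact ⟨1, ⟨hl, rfl⟩, hc, B, hS, hT⟩
  | 3, _, _ =>
    obtain ⟨u, hu0, hu⟩ := hu 0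
    obtain ⟨D, b, B, hD, hc, hS, hT⟩ := h.exists_basis₃ hd (hl 0) hu0 hu
    have h0 := hl 0
    have hdet := hdet' B
    simp only [hS, hT, det_pair₃ b h0 hD, det_pairT₃, Fin.prod_univ_three] at hdet
    obtain ⟨k0, k1, -⟩ := coeff_eq_zero_of_forall_mul_eq_zero (l := l 0)
      (k₀ := D / l 0 - l 1 * l 2) (k₁ := l 1 + l 2 - b / D) (k₂ := 0) (k₃ := 0) fun x => by
        linear_combination mul_left_cancel₀ (pow_ne_zero 2 hD) (hdet x)
    have hD' : D = l 0 * l 1 * l 2 := by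
      field_simp at k0
      linear_combination k0
    have hb : b = D * (l 1 + l 2) := by
      field_simp at k1
      linear_combination -k1
    subst hb
    subst hD'
    exact ⟨1, ⟨hl, rfl⟩, hc, B, hS, hT⟩
  | 4, _, _ =>
    obtain ⟨u, hu0, hu⟩ := hu 0
    obtain ⟨g, a, b, B, hg, hc, hS, hT⟩ := h.exists_basis₄ hd (hl 0) hu0 hu
    have h0 := hl 0
    have hdet := hdet' B
    simp only [hS, hT, det_pair₄ _ _ h0, det_pairT₄, Fin.prod_univ_four] at hdet
    obtain ⟨k0, k1, k2, -⟩ := coeff_eq_zero_of_forall_mul_eq_zero (l := l 0)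
      (k₀ := l 1 * l 2 * l 3 - g ^ 2 / l 0)
      (k₁ := g ^ 2 * b / l 0 - (l 1 * l 2 + l 1 * l 3 + l 2 * l 3))
      (k₂ := l 1 + l 2 + l 3 - a) (k₃ := 0) fun x => by
        linear_combination mul_left_cancel₀ (pow_ne_zero 4 hg) (hdet x)
    have hr : g ^ 2 = l 0 * l 1 * l 2 * l 3 := by
      field_simp at k0
      linear_combination -k0
    have ha : a = l 1 + l 2 + l 3 := by linear_combination -k2
    have hb : b = entryB₄ l g := by
      rw [entryB₄]
      field_simp at k1 ⊢
      linear_combination k1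
    subst ha hb
    exact ⟨g, ⟨hl, by rw [IsRoot, Fin.prod_univ_four]; exact hr⟩, hc, B, hS, hT⟩
  | 5, _, _ =>
    obtain ⟨u, hu0, hu⟩ := hu 0
    obtain ⟨g, a, b, e, B, hg, hc, hS, hT⟩ := h.exists_basis₅ hd (hl 0) hu0 hu
    have h0 := hl 0
    have hdet := hdet' B
    simp only [hS, hT, det_pair₅ _ _ _ h0 hg, det_pairT₅, Fin.prod_univ_five] at hdet
    obtain ⟨k0, k1, k2, k3⟩ := coeff_eq_zero_of_forall_mul_eq_zero (l := l 0)
      (k₀ := g ^ 5 / l 0 - l 1 * l 2 * l 3 * l 4)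
      (k₁ := (e + g ^ 2) * g ^ 2 / l 0 +
        (l 1 * l 2 * l 3 + l 1 * l 2 * l 4 + l 1 * l 3 * l 4 + l 2 * l 3 * l 4))
      (k₂ := -(b / g + a * g ^ 2 / l 0) -
        (l 1 * l 2 + l 1 * l 3 + l 1 * l 4 + l 2 * l 3 + l 2 * l 4 + l 3 * l 4))
      (k₃ := l 1 + l 2 + l 3 + l 4 - (a + e / g)) fun x => by
        linear_combination mul_left_cancel₀ (pow_ne_zero 10 hg) (hdet x)
    have hr : g ^ 5 = l 0 * l 1 * l 2 * l 3 * l 4 := by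
      field_simp at k0
      linear_combination k0
    have he : e = entryE₅ l g := by
      rw [entryE₅]
      field_simp at k1 ⊢
      linear_combination k1
    subst he
    have ha : a = entryA₅ l g := by rw [entryA₅]; linear_combination -k3
    subst ha
    have hb : b = entryB₅ l g := by
      rw [entryB₅]
      field_simp at k2 ⊢
      linear_combination -k2
    subst hb
    exact ⟨g, ⟨hl, by rw [IsRoot, Fin.prod_univ_five]; exact hr⟩, hc, B, hS, hT⟩

end Model

/-! ### The identity P₀(B) S P₁(B) e₀ = Q₀₁ λ₀ e₁ in the models -/

section Identity

open scoped Matrix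

variable {K : Type*}

theorem vec4_ext {a b c d a' b' c' d' : K} (h₀ : a = a') (h₁ : b = b') (h₂ : c = c')
    (h₃ : d = d') : ![a, b, c, d] = ![a', b', c', d'] := by
  rw [h₀, h₁, h₂, h₃]

theorem vec5_ext {a b c d e a' b' c' d' e' : K} (h₀ : a = a') (h₁ : b = b') (h₂ : c = c')
    (h₃ : d = d') (h₄ : e = e') : ![a, b, c, d, e] = ![a', b', c', d', e'] := by
  rw [h₀, h₁, h₂, h₃, h₄]

variable [Field K]

/-- A matrix of the shape taken by `σ₂` in the models of dimension `5`. -/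
def bandB₅ (l g E₁ E₂ E₃ k : K) : Matrix (Fin 5) (Fin 5) K :=
  !![0, 0, g ^ 6 / l, -E₂, 0; 0, l, 0, k, 0; 0, 0, 0, E₃ * l / g ^ 6, 1; 1, 0, 0, E₁, 0;
    0, 0, 0, -g⁻¹, 0]

theorem bandB₅_mulVec (l g E₁ E₂ E₃ k v₀ v₁ v₂ v₃ v₄ : K) :
    bandB₅ l g E₁ E₂ E₃ k *ᵥ ![v₀, v₁, v₂, v₃, v₄] =
      ![g ^ 6 / l * v₂ - E₂ * v₃, l * v₁ + k * v₃, E₃ * l / g ^ 6 * v₃ + v₄, v₀ + E₁ * v₃,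
        -(v₃ / g)] := by
  ext i
  fin_cases i <;> simp [bandB₅, Matrix.mulVec, dotProduct, Fin.sum_univ_succ] <;> ring

/-- The characteristic polynomial of the band matrix modulo the eigenvector. -/
theorem bandB₅_quartic {l g : K} (E₁ E₂ E₃ k v₀ v₁ v₂ v₃ v₄ : K) (hl : l ≠ 0) (hg : g ≠ 0) :
    aeval (bandB₅ l g E₁ E₂ E₃ k)
        (X ^ 4 - C E₁ * X ^ 3 + C E₂ * X ^ 2 - C E₃ * X + C (g ^ 5 / l)) *ᵥ
        ![v₀, v₁, v₂, v₃, v₄] =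
      ![0, l ^ 2 * k * v₀ + (l ^ 4 - E₁ * l ^ 3 + E₂ * l ^ 2 - E₃ * l + g ^ 5 / l) * v₁ +
        g ^ 6 * k * v₂ + l ^ 3 * k * v₃ + g ^ 6 * k / l * v₄, 0, 0, 0] := by
  simp only [map_add, map_sub, map_mul, aeval_X, aeval_C, pow_succ, pow_zero, one_mul,
    Matrix.add_mulVec, Matrix.sub_mulVec, ← Matrix.mulVec_mulVec, Algebra.algebraMap_eq_smul_one,
    Matrix.smul_mulVec, Matrix.one_mulVec, bandB₅_mulVec, Matrix.smul_cons, Matrix.smul_empty,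
    Matrix.cons_sub_cons, Matrix.cons_add_cons, Matrix.empty_sub_empty, Matrix.empty_add_empty,
    smul_eq_mul]
  refine vec5_ext ?_ ?_ ?_ ?_ ?_ <;> field_simp <;> ring

/-- Here a stands for `l 1`, and p₁, p₂ for the first two elementary symmetric functions of `l 2`,
`l 3`, `l 4`; the third is replaced by g⁵/(la). With the root relation eliminated in this way, what
remains are rational identities in free variables. -/
theorem pairB₅_eq_bandB₅ {l a g p₁ p₂ A b e : K} (hl : l ≠ 0) (ha : a ≠ 0) (hg : g ≠ 0)
    (he : e = -(a * p₂ + g ^ 5 / (l * a)) * l / g ^ 2 - g ^ 2) (hA : A = a + p₁ - e / g)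
    (hb : b = -(a * p₁ + p₂) * g - A * g ^ 3 / l) :
    pairB₅ l g A b e = bandB₅ l g (a + p₁) (a * p₁ + p₂) (a * p₂ + g ^ 5 / (l * a))
      ((g ^ 6 + a * g ^ 4 * p₁ + a * g ^ 5 + a ^ 2 * g ^ 4 + l * g ^ 5 + l * a * g ^ 2 * p₂ +
        l * a * g ^ 3 * p₁ + l * a * g ^ 4 + l * a ^ 2 * g * p₂ + l * a ^ 2 * g ^ 2 * p₁ +
        l * a ^ 2 * g ^ 3 + l ^ 2 * a ^ 2 * p₂) / (a * g ^ 5)) := by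
  have h₀ : b / g + A * g ^ 2 / l = -(a * p₁ + p₂) := by rw [hb]; field_simp; ring
  have h₂ : -(e + g ^ 2) / g ^ 4 = (a * p₂ + g ^ 5 / (l * a)) * l / g ^ 6 := by
    rw [he]; field_simp; ring
  have h₃ : A + e / g = a + p₁ := by rw [hA]; ring
  have h₁ : (A * g ^ 2 - b) * l / g ^ 4 =
      (g ^ 6 + a * g ^ 4 * p₁ + a * g ^ 5 + a ^ 2 * g ^ 4 + l * g ^ 5 + l * a * g ^ 2 * p₂ +
        l * a * g ^ 3 * p₁ + l * a * g ^ 4 + l * a ^ 2 * g * p₂ + l * a ^ 2 * g ^ 2 * p₁ +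
        l * a ^ 2 * g ^ 3 + l ^ 2 * a ^ 2 * p₂) / (a * g ^ 5) := by
    rw [hb, hA, he]; field_simp; ring
  rw [pairB₅, bandB₅, h₀, h₁, h₂, h₃]

/-- This is P₁(B)e₀ with the factor X - l left out. It serves the main identity and also the
nonvanishing of P₁(B)e₀. -/
theorem bandB₅_cubic {l a g : K} (p₁ p₂ k : K) (hl : l ≠ 0) (ha : a ≠ 0) (hg : g ≠ 0) :
    aeval (bandB₅ l g (a + p₁) (a * p₁ + p₂) (a * p₂ + g ^ 5 / (l * a)) k)
        (X ^ 3 - C p₁ * X ^ 2 + C p₂ * X - C (g ^ 5 / (l * a))) *ᵥ ![1, 0, 0, 0, 0] =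
      ![-a ^ 2 * p₁, (l + a) * k, l * a ^ 2 * p₂ / g ^ 6, a ^ 2, -a / g] := by
  simp only [map_add, map_sub, map_mul, aeval_X, aeval_C, pow_succ, pow_zero, one_mul,
    Matrix.add_mulVec, Matrix.sub_mulVec, ← Matrix.mulVec_mulVec, Algebra.algebraMap_eq_smul_one,
    Matrix.smul_mulVec, Matrix.one_mulVec, bandB₅_mulVec, Matrix.smul_cons, Matrix.smul_empty,
    Matrix.cons_sub_cons, Matrix.cons_add_cons, Matrix.empty_sub_empty, Matrix.empty_add_empty,
    smul_eq_mul]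
  refine vec5_ext ?_ ?_ ?_ ?_ ?_ <;> field_simp <;> ring

theorem bandB₅_linear {l a g : K} (p₁ p₂ k : K) (hl : l ≠ 0) (ha : a ≠ 0) (hg : g ≠ 0) :
    aeval (bandB₅ l g (a + p₁) (a * p₁ + p₂) (a * p₂ + g ^ 5 / (l * a)) k) (X - C l) *ᵥ
        ![-a ^ 2 * p₁, (l + a) * k, l * a ^ 2 * p₂ / g ^ 6, a ^ 2, -a / g] =
      ![(l - a) * a ^ 2 * p₁, a ^ 2 * k, (a - l) * l * a ^ 2 * p₂ / g ^ 6, (a - l) * a ^ 2,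
        (l - a) * a / g] := by
  simp only [map_sub, aeval_X, aeval_C, Matrix.sub_mulVec, Algebra.algebraMap_eq_smul_one,
    Matrix.smul_mulVec, Matrix.one_mulVec, bandB₅_mulVec, Matrix.smul_cons, Matrix.smul_empty,
    Matrix.cons_sub_cons, Matrix.empty_sub_empty, smul_eq_mul, pow_succ, pow_zero, one_mul]
  refine vec5_ext ?_ ?_ ?_ ?_ ?_ <;> field_simp <;> ring

theorem pairS₅_mulVec (l g b e v₀ v₁ v₂ v₃ v₄ : K) :
    pairS₅ l g b e *ᵥ ![v₀, v₁, v₂, v₃, v₄] =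
      ![g ^ 6 / l * v₁ - g ^ 3 * b * v₄, l * v₀ + l * b * v₄, v₃ + e * v₄,
        g ^ 6 * v₂ - g ^ 3 * e * v₄, g ^ 3 * v₄] := by
  ext i
  fin_cases i <;> simp [pairS₅, Matrix.mulVec, dotProduct, Fin.sum_univ_succ] <;> ring

/-- The cubic, the factor X - l, S and the quartic act one after another. The quartic is the
characteristic polynomial of B modulo the line of its eigenvector e₁, so only the e₁-coordinate
survives, and that coordinate is the product of the factors of Q₀₁. -/
theorem pair₅_identity {l a g p₁ p₂ A b e : K} (hl : l ≠ 0) (ha : a ≠ 0) (hg : g ≠ 0)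
    (he : e = -(a * p₂ + g ^ 5 / (l * a)) * l / g ^ 2 - g ^ 2) (hA : A = a + p₁ - e / g)
    (hb : b = -(a * p₁ + p₂) * g - A * g ^ 3 / l) :
    aeval (pairB₅ l g A b e) (X ^ 4 - C (a + p₁) * X ^ 3 + C (a * p₁ + p₂) * X ^ 2 -
        C (a * p₂ + g ^ 5 / (l * a)) * X + C (g ^ 5 / l)) *ᵥ (pairS₅ l g b e *ᵥ
      (aeval (pairB₅ l g A b e) (X - C l) *ᵥ (aeval (pairB₅ l g A b e)
        (X ^ 3 - C p₁ * X ^ 2 + C p₂ * X - C (g ^ 5 / (l * a))) *ᵥ ![1, 0, 0, 0, 0]))) =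
      ![0, (g ^ 8)⁻¹ * (g ^ 2 + l * g + l ^ 2) * (g ^ 2 + a * g + a ^ 2) *
        ((g ^ 6 + g ^ 4 * l * p₁ + g ^ 2 * l ^ 2 * p₂ + l ^ 3 * (g ^ 5 / (l * a))) *
          (g ^ 6 + g ^ 4 * a * p₁ + g ^ 2 * a ^ 2 * p₂ + a ^ 3 * (g ^ 5 / (l * a)))) * l,
        0, 0, 0] := by
  rw [pairB₅_eq_bandB₅ hl ha hg he hA hb, bandB₅_cubic _ _ _ hl ha hg,
    bandB₅_linear _ _ _ hl ha hg, pairS₅_mulVec, bandB₅_quartic _ _ _ _ _ _ _ _ _ hl hg]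
  refine vec5_ext rfl ?_ rfl rfl rfl
  rw [hb, hA, he]
  field_simp
  ring

theorem P_zero_five (l : Fin 5 → K) : P l 0 =
    X ^ 4 - C (l 1 + (l 2 + l 3 + l 4)) * X ^ 3 +
      C (l 1 * (l 2 + l 3 + l 4) + (l 2 * l 3 + l 2 * l 4 + l 3 * l 4)) * X ^ 2 -
      C (l 1 * (l 2 * l 3 + l 2 * l 4 + l 3 * l 4) + l 2 * l 3 * l 4) * X +
      C (l 1 * l 2 * l 3 * l 4) := by
  rw [P, show (Finset.univ.erase (0 : Fin 5)) = {1, 2, 3, 4} by decide,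
    Finset.prod_insert (by decide), Finset.prod_insert (by decide),
    Finset.prod_insert (by decide), Finset.prod_singleton]
  simp only [C_add, C_mul]
  ring

theorem prod_erase_five (l : Fin 5 → K) :
    ∏ i ∈ (Finset.univ.erase 1).erase (0 : Fin 5), (X - C (l i)) =
      X ^ 3 - C (l 2 + l 3 + l 4) * X ^ 2 + C (l 2 * l 3 + l 2 * l 4 + l 3 * l 4) * X -
        C (l 2 * l 3 * l 4) := by
  rw [show ((Finset.univ.erase 1).erase (0 : Fin 5)) = {2, 3, 4} by decide,
    Finset.prod_insert (by decide), Finset.prod_insert (by decide), Finset.prod_singleton]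
  simp only [C_add, C_mul]
  ring

theorem P_eq_mul_prod_erase {d : ℕ} (l : Fin d → K) {r s : Fin d} (hrs : r ≠ s) :
    P l s = (X - C (l r)) * ∏ i ∈ (Finset.univ.erase s).erase r, (X - C (l i)) :=
  (Finset.mul_prod_erase _ _ (Finset.mem_erase.2 ⟨hrs, Finset.mem_univ r⟩)).symm

theorem entries_five {l : Fin 5 → K} (g : K) (hp : l 2 * l 3 * l 4 = g ^ 5 / (l 0 * l 1)) :
    entryE₅ l g = -(l 1 * (l 2 * l 3 + l 2 * l 4 + l 3 * l 4) + g ^ 5 / (l 0 * l 1)) *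
      l 0 / g ^ 2 - g ^ 2 ∧
    entryA₅ l g = l 1 + (l 2 + l 3 + l 4) - entryE₅ l g / g ∧
    entryB₅ l g = -(l 1 * (l 2 + l 3 + l 4) + (l 2 * l 3 + l 2 * l 4 + l 3 * l 4)) * g -
      entryA₅ l g * g ^ 3 / l 0 := by
  refine ⟨?_, ?_, ?_⟩
  · rw [entryE₅, ← hp]; ring
  · rw [entryA₅]; ring
  · rw [entryB₅]; ring

/-- This is the image under δ of P₀(A)P₁(B)e₀ = Q₀₁e₀, because δP₀(A) = P₀(B)δ and Se₀ = λ₀e₁. In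
this form only the matrices of σ₂ and δ occur. -/
theorem model_identity_five {p : Param K 5} (hp : p ∈ paramSpace K 5) :
    aeval (modelB p) (P p.1 0) *ᵥ (modelS p *ᵥ
      (aeval (modelB p) (P p.1 1) *ᵥ Pi.single 0 1)) = (Q p 0 1 * p.1 0) • Pi.single 1 1 := by
  obtain ⟨l, g⟩ := p
  have h0 : l 0 ≠ 0 := hp.1 0
  have h1 : l 1 ≠ 0 := hp.1 1
  have hg : g ≠ 0 := snd_ne_zero_of_five hp
  have hr : g ^ 5 = _ := hp.2
  rw [Fin.prod_univ_five] at hr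
  have hp3 : l 2 * l 3 * l 4 = g ^ 5 / (l 0 * l 1) := by
    rw [hr]; field_simp
  have hp4 : l 1 * l 2 * l 3 * l 4 = g ^ 5 / l 0 := by
    rw [hr]; field_simp
  obtain ⟨he, hA, hb⟩ := entries_five g hp3
  have key := pair₅_identity h0 h1 hg he hA hb
  have hsingle : (Pi.single 0 1 : Fin 5 → K) = ![1, 0, 0, 0, 0] := by
    ext i; fin_cases i <;> rfl
  have hQ : Q (l, g) 0 1 = (g ^ 8)⁻¹ * (g ^ 2 + l 0 * g + l 0 ^ 2) *
      (g ^ 2 + l 1 * g + l 1 ^ 2) * ((g ^ 6 + g ^ 4 * l 0 * (l 2 + l 3 + l 4) +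
        g ^ 2 * l 0 ^ 2 * (l 2 * l 3 + l 2 * l 4 + l 3 * l 4) + l 0 ^ 3 * (g ^ 5 / (l 0 * l 1))) *
      (g ^ 6 + g ^ 4 * l 1 * (l 2 + l 3 + l 4) + g ^ 2 * l 1 ^ 2 *
        (l 2 * l 3 + l 2 * l 4 + l 3 * l 4) + l 1 ^ 3 * (g ^ 5 / (l 0 * l 1)))) := by
    rw [← hp3, Q, show (({0, 1} : Finset (Fin 5))ᶜ) = {2, 3, 4} by decide,
      Finset.prod_insert (by decide), Finset.prod_insert (by decide), Finset.prod_singleton]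
    ring
  rw [P_eq_mul_prod_erase l (show (0 : Fin 5) ≠ 1 by decide), prod_erase_five, P_zero_five, hp3,
    hp4, hsingle, map_mul, ← Matrix.mulVec_mulVec]
  refine key.trans ?_
  rw [hQ]
  ext i
  fin_cases i <;> simp

/-- If P₁(B)e₀ vanished, this vector would be a λ₀-eigenvector of B; in a simple model such vectors
lie on the line of e₁. A nonzero coordinate off that line is what `modelRep_aeval_ne_zero` needs. -/
theorem model_cyclic_five {p : Param K 5} (hp : p ∈ paramSpace K 5) :
    ∃ j, j ≠ 1 ∧ (aeval (modelB p) (∏ i ∈ (Finset.univ.erase 1).erase (0 : Fin 5),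
      (X - C (p.1 i))) *ᵥ Pi.single 0 1) j ≠ 0 := by
  obtain ⟨l, g⟩ := p
  have h0 : l 0 ≠ 0 := hp.1 0
  have h1 : l 1 ≠ 0 := hp.1 1
  have hg : g ≠ 0 := snd_ne_zero_of_five hp
  have hr : g ^ 5 = _ := hp.2
  rw [Fin.prod_univ_five] at hr
  have hp3 : l 2 * l 3 * l 4 = g ^ 5 / (l 0 * l 1) := by
    rw [hr]; field_simp
  obtain ⟨he, hA, hb⟩ := entries_five g hp3
  have hsingle : (Pi.single 0 1 : Fin 5 → K) = ![1, 0, 0, 0, 0] := by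
    ext i; fin_cases i <;> rfl
  refine ⟨3, by decide, ?_⟩
  rw [modelB, prod_erase_five, hp3, hsingle, pairB₅_eq_bandB₅ h0 h1 hg he hA hb,
    bandB₅_cubic _ _ _ h0 h1 hg]
  exact pow_ne_zero 2 h1

/-- A matrix of the shape taken by `σ₂` in the models of dimension `4`. -/
def bandB₄ (l g E₁ E₂ k : K) : Matrix (Fin 4) (Fin 4) K :=
  !![0, 0, -g ^ 3 / l, -E₂; 0, l, 0, k; 0, 0, 0, -g⁻¹; 1, 0, 0, E₁]

theorem bandB₄_mulVec (l g E₁ E₂ k v₀ v₁ v₂ v₃ : K) :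
    bandB₄ l g E₁ E₂ k *ᵥ ![v₀, v₁, v₂, v₃] =
      ![-(g ^ 3 / l * v₂) - E₂ * v₃, l * v₁ + k * v₃, -(v₃ / g), v₀ + E₁ * v₃] := by
  ext i
  fin_cases i <;> simp [bandB₄, Matrix.mulVec, dotProduct, Fin.sum_univ_succ] <;> ring

/-- The characteristic polynomial of the band matrix modulo the eigenvector. -/
theorem bandB₄_cubic {l g : K} (E₁ E₂ k v₀ v₁ v₂ v₃ : K) (hl : l ≠ 0) (hg : g ≠ 0) :
    aeval (bandB₄ l g E₁ E₂ k) (X ^ 3 - C E₁ * X ^ 2 + C E₂ * X - C (g ^ 2 / l)) *ᵥ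
        ![v₀, v₁, v₂, v₃] =
      ![0, l * k * v₀ + (l ^ 3 - E₁ * l ^ 2 + E₂ * l - g ^ 2 / l) * v₁ -
        g ^ 3 * k / l * v₂ + l ^ 2 * k * v₃, 0, 0] := by
  simp only [map_add, map_sub, map_mul, aeval_X, aeval_C, pow_succ, pow_zero, one_mul,
    Matrix.add_mulVec, Matrix.sub_mulVec, ← Matrix.mulVec_mulVec, Algebra.algebraMap_eq_smul_one,
    Matrix.smul_mulVec, Matrix.one_mulVec, bandB₄_mulVec, Matrix.smul_cons, Matrix.smul_empty,
    Matrix.cons_sub_cons, Matrix.cons_add_cons, Matrix.empty_sub_empty, Matrix.empty_add_empty,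
    smul_eq_mul]
  refine vec4_ext ?_ ?_ ?_ ?_ <;> field_simp <;> ring

theorem bandB₄_quadratic {l a g : K} (q k : K) (hl : l ≠ 0) (ha : a ≠ 0) (hg : g ≠ 0) :
    aeval (bandB₄ l g (a + q) (a * q + g ^ 2 / (l * a)) k)
        (X ^ 2 - C q * X + C (g ^ 2 / (l * a))) *ᵥ ![1, 0, 0, 0] =
      ![-a * q, k, -1 / g, a] := by
  simp only [map_add, map_sub, map_mul, aeval_X, aeval_C, pow_succ, pow_zero, one_mul,
    Matrix.add_mulVec, Matrix.sub_mulVec, ← Matrix.mulVec_mulVec, Algebra.algebraMap_eq_smul_one,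
    Matrix.smul_mulVec, Matrix.one_mulVec, bandB₄_mulVec, Matrix.smul_cons, Matrix.smul_empty,
    Matrix.cons_sub_cons, Matrix.cons_add_cons, Matrix.empty_sub_empty, Matrix.empty_add_empty,
    smul_eq_mul]
  refine vec4_ext ?_ ?_ ?_ ?_ <;> field_simp <;> ring

theorem bandB₄_linear {l a g : K} (q k : K) (hl : l ≠ 0) (ha : a ≠ 0) (hg : g ≠ 0) :
    aeval (bandB₄ l g (a + q) (a * q + g ^ 2 / (l * a)) k) (X - C l) *ᵥ ![-a * q, k, -1 / g, a] =
      ![(l - a) * a * q, a * k, (l - a) / g, (a - l) * a] := by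
  simp only [map_sub, aeval_X, aeval_C, Matrix.sub_mulVec, Algebra.algebraMap_eq_smul_one,
    Matrix.smul_mulVec, Matrix.one_mulVec, bandB₄_mulVec, Matrix.smul_cons, Matrix.smul_empty,
    Matrix.cons_sub_cons, Matrix.empty_sub_empty, smul_eq_mul, pow_succ, pow_zero, one_mul]
  refine vec4_ext ?_ ?_ ?_ ?_ <;> field_simp <;> ring

theorem pairS₄_mulVec (l g v₀ v₁ v₂ v₃ : K) :
    pairS₄ l g *ᵥ ![v₀, v₁, v₂, v₃] = ![-(g ^ 3 / l * v₁), l * v₀, v₃, -(g ^ 3 * v₂)] := by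
  ext i
  fin_cases i <;> simp [pairS₄, Matrix.mulVec, dotProduct, Fin.sum_univ_succ]
  ring

/-- As in dimension 5, the root relation is eliminated: `l 2` and `l 3` enter only through their sum
and their product g²/(λ₀λ₁). -/
theorem modelB_four_eq {l : Fin 4 → K} {g : K} (hg : g ≠ 0) (h0 : l 0 ≠ 0)
    (hq : l 2 * l 3 = g ^ 2 / (l 0 * l 1)) :
    modelB (l, g) = bandB₄ (l 0) g (l 1 + (l 2 + l 3))
      (l 1 * (l 2 + l 3) + g ^ 2 / (l 0 * l 1))
      (l 0 ^ 2 * (l 1 * (l 2 + l 3) + g ^ 2 / (l 0 * l 1)) / g ^ 2 +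
        l 0 * (l 1 + (l 2 + l 3)) / g) := by
  rw [modelB, pairB₄, bandB₄, ← hq, entryB₄,
    show g ^ 2 * (l 0 * (l 1 * l 2 + l 1 * l 3 + l 2 * l 3) / g ^ 2) / l 0 =
      l 1 * (l 2 + l 3) + l 2 * l 3 by field_simp,
    show l 0 * (l 0 * (l 1 * l 2 + l 1 * l 3 + l 2 * l 3) / g ^ 2) + l 0 * (l 1 + l 2 + l 3) / g =
      l 0 ^ 2 * (l 1 * (l 2 + l 3) + l 2 * l 3) / g ^ 2 + l 0 * (l 1 + (l 2 + l 3)) / g by ring,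
    add_assoc (l 1)]

theorem P_zero_four (l : Fin 4 → K) : P l 0 =
    X ^ 3 - C (l 1 + (l 2 + l 3)) * X ^ 2 + C (l 1 * (l 2 + l 3) + l 2 * l 3) * X -
      C (l 1 * l 2 * l 3) := by
  rw [P, show (Finset.univ.erase (0 : Fin 4)) = {1, 2, 3} by decide,
    Finset.prod_insert (by decide), Finset.prod_insert (by decide), Finset.prod_singleton]
  simp only [C_add, C_mul]
  ring

theorem prod_erase_four (l : Fin 4 → K) :
    ∏ i ∈ (Finset.univ.erase 1).erase (0 : Fin 4), (X - C (l i)) =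
      X ^ 2 - C (l 2 + l 3) * X + C (l 2 * l 3) := by
  rw [show ((Finset.univ.erase 1).erase (0 : Fin 4)) = {2, 3} by decide,
    Finset.prod_insert (by decide), Finset.prod_singleton]
  simp only [C_add, C_mul]
  ring

theorem model_identity_four {p : Param K 4} (hp : p ∈ paramSpace K 4) :
    aeval (modelB p) (P p.1 0) *ᵥ (modelS p *ᵥ
      (aeval (modelB p) (P p.1 1) *ᵥ Pi.single 0 1)) = (Q p 0 1 * p.1 0) • Pi.single 1 1 := by
  obtain ⟨l, g⟩ := p
  have h0 : l 0 ≠ 0 := hp.1 0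
  have h1 : l 1 ≠ 0 := hp.1 1
  have hg : g ≠ 0 := snd_ne_zero_of_four hp
  have hr : g ^ 2 = _ := hp.2
  rw [Fin.prod_univ_four] at hr
  have hq : l 2 * l 3 = g ^ 2 / (l 0 * l 1) := by
    rw [hr]; field_simp
  have hq' : l 1 * l 2 * l 3 = g ^ 2 / l 0 := by
    rw [hr]; field_simp
  have hsingle : (Pi.single 0 1 : Fin 4 → K) = ![1, 0, 0, 0] := by
    ext i; fin_cases i <;> rfl
  -- The product of the last two factors of Q is symmetric in `l 2` and `l 3`, so it can be written
  -- in their sum and product.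
  have hQ : Q (l, g) 0 1 = -g⁻¹ * (l 0 ^ 2 + g) * (l 1 ^ 2 + g) *
      (g ^ 2 + g * (l 0 + l 1) * (l 2 + l 3) + (l 0 ^ 2 + l 1 ^ 2) * (g ^ 2 / (l 0 * l 1)) +
        l 0 * l 1 * ((l 2 + l 3) ^ 2 - 2 * (g ^ 2 / (l 0 * l 1)))) := by
    rw [← hq, Q, show (({0, 1} : Finset (Fin 4))ᶜ).offDiag = {(2, 3), (3, 2)} by decide,
      Finset.prod_insert (by decide), Finset.prod_singleton]
    ring
  rw [P_eq_mul_prod_erase l (show (0 : Fin 4) ≠ 1 by decide), prod_erase_four, P_zero_four, hq,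
    hq', hsingle, map_mul, ← Matrix.mulVec_mulVec, modelB_four_eq hg h0 hq,
    bandB₄_quadratic _ _ h0 h1 hg, bandB₄_linear _ _ h0 h1 hg, modelS, pairS₄_mulVec,
    bandB₄_cubic _ _ _ _ _ _ _ h0 hg, hQ]
  trans ![0, (-g⁻¹ * (l 0 ^ 2 + g) * (l 1 ^ 2 + g) *
      (g ^ 2 + g * (l 0 + l 1) * (l 2 + l 3) + (l 0 ^ 2 + l 1 ^ 2) * (g ^ 2 / (l 0 * l 1)) +
        l 0 * l 1 * ((l 2 + l 3) ^ 2 - 2 * (g ^ 2 / (l 0 * l 1))))) * l 0, 0, 0]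
  · refine vec4_ext rfl ?_ rfl rfl
    field_simp
    ring
  · ext i
    fin_cases i <;> simp

theorem model_cyclic_four {p : Param K 4} (hp : p ∈ paramSpace K 4) :
    ∃ j, j ≠ 1 ∧ (aeval (modelB p) (∏ i ∈ (Finset.univ.erase 1).erase (0 : Fin 4),
      (X - C (p.1 i))) *ᵥ Pi.single 0 1) j ≠ 0 := by
  obtain ⟨l, g⟩ := p
  have h0 : l 0 ≠ 0 := hp.1 0
  have h1 : l 1 ≠ 0 := hp.1 1
  have hg : g ≠ 0 := snd_ne_zero_of_four hp
  have hr : g ^ 2 = _ := hp.2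
  rw [Fin.prod_univ_four] at hr
  have hq : l 2 * l 3 = g ^ 2 / (l 0 * l 1) := by
    rw [hr]; field_simp
  have hsingle : (Pi.single 0 1 : Fin 4 → K) = ![1, 0, 0, 0] := by
    ext i; fin_cases i <;> rfl
  refine ⟨3, by decide, ?_⟩
  rw [prod_erase_four, hq, hsingle, modelB_four_eq hg h0 hq, bandB₄_quadratic _ _ h0 h1 hg]
  exact h1

theorem pairB₃_mulVec (l D b v₀ v₁ v₂ : K) :
    pairB₃ l D b *ᵥ ![v₀, v₁, v₂] =
      ![b / D * v₀ + D ^ 2 / l * v₂, l * b / D ^ 2 * v₀ + l * v₁, -(v₀ / D)] := by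
  ext i
  fin_cases i <;> simp [pairB₃, Matrix.mulVec, dotProduct, Fin.sum_univ_succ]
  ring

theorem pairS₃_mulVec (l D b v₀ v₁ v₂ : K) :
    pairS₃ l D b *ᵥ ![v₀, v₁, v₂] =
      ![D ^ 2 / l * v₁ + D * b * v₂, l * v₀ + l * b * v₂, -(D * v₂)] := by
  ext i
  fin_cases i <;> simp [pairS₃, Matrix.mulVec, dotProduct, Fin.sum_univ_succ]

theorem model_identity_three {p : Param K 3} (hp : p ∈ paramSpace K 3) :
    aeval (modelB p) (P p.1 0) *ᵥ (modelS p *ᵥ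
      (aeval (modelB p) (P p.1 1) *ᵥ Pi.single 0 1)) = (Q p 0 1 * p.1 0) • Pi.single 1 1 := by
  obtain ⟨l, g⟩ := p
  have h0 : l 0 ≠ 0 := hp.1 0
  have h1 : l 1 ≠ 0 := hp.1 1
  have h2 : l 2 ≠ 0 := hp.1 2
  have hP0 : P l 0 = (X - C (l 1)) * (X - C (l 2)) := by
    rw [P, show (Finset.univ.erase (0 : Fin 3)) = {1, 2} by decide,
      Finset.prod_insert (by decide), Finset.prod_singleton]
  have hP1 : P l 1 = (X - C (l 0)) * (X - C (l 2)) := by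
    rw [P, show (Finset.univ.erase (1 : Fin 3)) = {0, 2} by decide,
      Finset.prod_insert (by decide), Finset.prod_singleton]
  have hsingle : (Pi.single 0 1 : Fin 3 → K) = ![1, 0, 0] := by
    ext i; fin_cases i <;> rfl
  have hsingle' : (Pi.single 1 1 : Fin 3 → K) = ![0, 1, 0] := by
    ext i; fin_cases i <;> rfl
  have hQ : Q (l, g) 0 1 = (l 0 ^ 2 + l 1 * l 2) * (l 1 ^ 2 + l 0 * l 2) := by
    rw [Q, show (({0, 1} : Finset (Fin 3))ᶜ) = {2} by decide, Finset.prod_singleton]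
  simp only [hP0, hP1, hsingle, hsingle', hQ, modelB, modelS, map_sub, map_mul, aeval_X, aeval_C,
    Matrix.sub_mulVec, ← Matrix.mulVec_mulVec, Algebra.algebraMap_eq_smul_one,
    Matrix.smul_mulVec, Matrix.one_mulVec, pairB₃_mulVec, pairS₃_mulVec, Matrix.smul_cons,
    Matrix.smul_empty, Matrix.cons_sub_cons, Matrix.empty_sub_empty, smul_eq_mul]
  refine congrArg₂ Matrix.vecCons ?_ (congrArg₂ Matrix.vecCons ?_ (congrArg₂ Matrix.vecCons ?_ rfl))
    <;> field_simp <;> ring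

theorem model_cyclic_three {p : Param K 3} (hp : p ∈ paramSpace K 3) :
    ∃ j, j ≠ 1 ∧ (aeval (modelB p) (∏ i ∈ (Finset.univ.erase 1).erase (0 : Fin 3),
      (X - C (p.1 i))) *ᵥ Pi.single 0 1) j ≠ 0 := by
  obtain ⟨l, g⟩ := p
  have h0 : l 0 ≠ 0 := hp.1 0
  have h1 : l 1 ≠ 0 := hp.1 1
  have h2 : l 2 ≠ 0 := hp.1 2
  have hsingle : (Pi.single 0 1 : Fin 3 → K) = ![1, 0, 0] := by
    ext i; fin_cases i <;> rfl
  refine ⟨2, by decide, ?_⟩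
  rw [show ((Finset.univ.erase 1).erase (0 : Fin 3)) = {2} by decide, Finset.prod_singleton,
    hsingle]
  simp [modelB, Matrix.sub_mulVec, Algebra.algebraMap_eq_smul_one, Matrix.smul_mulVec,
    pairB₃_mulVec, h0, h1, h2]

theorem pairB₂_mulVec (l y v₀ v₁ : K) :
    pairB₂ l y *ᵥ ![v₀, v₁] = ![y / l * v₀, l / y * v₀ + l * v₁] := by
  ext i
  fin_cases i <;> simp [pairB₂, Matrix.mulVec, dotProduct, Fin.sum_univ_succ]

theorem pairS₂_mulVec (l y v₀ v₁ : K) :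
    pairS₂ l y *ᵥ ![v₀, v₁] = ![-(y ^ 3 / l * v₁), l * v₀] := by
  ext i
  fin_cases i <;> simp [pairS₂, Matrix.mulVec, dotProduct, Fin.sum_univ_succ, neg_div]

theorem model_identity_two {p : Param K 2} (hp : p ∈ paramSpace K 2) :
    aeval (modelB p) (P p.1 0) *ᵥ (modelS p *ᵥ
      (aeval (modelB p) (P p.1 1) *ᵥ Pi.single 0 1)) = (Q p 0 1 * p.1 0) • Pi.single 1 1 := by
  obtain ⟨l, g⟩ := p
  have h0 : l 0 ≠ 0 := hp.1 0
  have h1 : l 1 ≠ 0 := hp.1 1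
  have hP0 : P l 0 = X - C (l 1) := by
    rw [P, show (Finset.univ.erase (0 : Fin 2)) = {1} by decide, Finset.prod_singleton]
  have hP1 : P l 1 = X - C (l 0) := by
    rw [P, show (Finset.univ.erase (1 : Fin 2)) = {0} by decide, Finset.prod_singleton]
  have hsingle : (Pi.single 0 1 : Fin 2 → K) = ![1, 0] := by
    ext i; fin_cases i <;> rfl
  have hsingle' : (Pi.single 1 1 : Fin 2 → K) = ![0, 1] := by
    ext i; fin_cases i <;> rfl
  simp only [hP0, hP1, hsingle, hsingle', Q, modelB, modelS, map_sub, aeval_X, aeval_C,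
    Matrix.sub_mulVec, Algebra.algebraMap_eq_smul_one,
    Matrix.smul_mulVec, Matrix.one_mulVec, pairB₂_mulVec, pairS₂_mulVec, Matrix.smul_cons,
    Matrix.smul_empty, Matrix.cons_sub_cons, Matrix.empty_sub_empty, smul_eq_mul]
  refine congrArg₂ Matrix.vecCons ?_ (congrArg₂ Matrix.vecCons ?_ rfl)
    <;> field_simp <;> ring

theorem model_cyclic_two (p : Param K 2) :
    ∃ j, j ≠ 1 ∧ (aeval (modelB p) (∏ i ∈ (Finset.univ.erase 1).erase (0 : Fin 2),
      (X - C (p.1 i))) *ᵥ Pi.single 0 1) j ≠ 0 := by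
  refine ⟨0, by decide, ?_⟩
  rw [show ((Finset.univ.erase 1).erase (0 : Fin 2)) = ∅ by decide]
  simp

theorem model_identity {n : ℕ} (hn : n ≤ 3) {p : Param K (n + 2)}
    (hp : p ∈ paramSpace K (n + 2)) :
    aeval (modelB p) (P p.1 0) *ᵥ (modelS p *ᵥ
      (aeval (modelB p) (P p.1 1) *ᵥ Pi.single 0 1)) = (Q p 0 1 * p.1 0) • Pi.single 1 1 := by
  interval_cases n
  · exact model_identity_two hp
  · exact model_identity_three hp
  · exact model_identity_four hp
  · exact model_identity_five hp

theorem model_cyclic {n : ℕ} (hn : n ≤ 3) {p : Param K (n + 2)}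
    (hp : p ∈ paramSpace K (n + 2)) :
    ∃ j, j ≠ 1 ∧ (aeval (modelB p) (∏ i ∈ (Finset.univ.erase 1).erase (0 : Fin (n + 2)),
      (X - C (p.1 i))) *ᵥ Pi.single 0 1) j ≠ 0 := by
  interval_cases n
  · exact model_cyclic_two p
  · exact model_cyclic_three hp
  · exact model_cyclic_four hp
  · exact model_cyclic_five hp

theorem modelS_mulVec_single {n : ℕ} (hn : n ≤ 3) (p : Param K (n + 2)) :
    modelS p *ᵥ Pi.single 0 1 = p.1 0 • Pi.single 1 1 := by
  interval_cases n <;> obtain ⟨l, g⟩ := p <;> ext i <;> fin_cases i <;>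
    simp [modelS, pairS₂, pairS₃, pairS₄, pairS₅]

theorem modelT_mulVec_single {n : ℕ} (hn : n ≤ 3) (p : Param K (n + 2)) :
    modelT p *ᵥ Pi.single 0 1 = Pi.single 1 1 := by
  interval_cases n <;> obtain ⟨l, g⟩ := p <;> ext i <;> fin_cases i <;>
    simp [modelT, pairT₂, pairT₃, pairT₄, pairT₅]

/-- The model depends symmetrically on all the eigenvalues but the first. -/
theorem model_swap {n : ℕ} (hn : n ≤ 3) (p : Param K (n + 2)) {s : Fin (n + 2)} (hs : s ≠ 0) :
    modelC (p.1 ∘ Equiv.swap 1 s, p.2) = modelC p ∧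
    modelS (p.1 ∘ Equiv.swap 1 s, p.2) = modelS p ∧
    modelT (p.1 ∘ Equiv.swap 1 s, p.2) = modelT p := by
  obtain ⟨l, g⟩ := p
  obtain ⟨m, hm⟩ : ∃ m, m = l ∘ Equiv.swap 1 s := ⟨_, rfl⟩
  have h0 : m 0 = l 0 := by
    rw [hm, Function.comp_apply, Equiv.swap_apply_of_ne_of_ne (by simp) hs.symm]
  rw [← hm]
  interval_cases n
  · have h : m 1 = l 1 := by
      fin_cases s
      · exact absurd rfl hs
      · rw [hm]; rfl
    simp only [modelC, modelS, modelT, h0, h, true_and]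
  · have h : m 1 = l 1 ∧ m 2 = l 2 ∨ m 1 = l 2 ∧ m 2 = l 1 := by
      rw [hm]
      fin_cases s
      · exact absurd rfl hs
      · exact Or.inl ⟨rfl, rfl⟩
      · exact Or.inr ⟨rfl, rfl⟩
    have h1 : m 1 + m 2 = l 1 + l 2 := by
      rcases h with ⟨h, h'⟩ | ⟨h, h'⟩
      · rw [h, h']
      · rw [h, h']; ring
    have h2 : m 1 * m 2 = l 1 * l 2 := by
      rcases h with ⟨h, h'⟩ | ⟨h, h'⟩
      · rw [h, h']
      · rw [h, h']; ring
    simp only [modelC, modelS, modelT, mul_assoc, h0, h1, h2, true_and]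
  · have h : m 1 = l 1 ∧ m 2 = l 2 ∧ m 3 = l 3 ∨ m 1 = l 2 ∧ m 2 = l 1 ∧ m 3 = l 3 ∨
        m 1 = l 3 ∧ m 2 = l 2 ∧ m 3 = l 1 := by
      rw [hm]
      fin_cases s
      · exact absurd rfl hs
      · exact Or.inl ⟨rfl, rfl, rfl⟩
      · exact Or.inr (Or.inl ⟨rfl, rfl, rfl⟩)
      · exact Or.inr (Or.inr ⟨rfl, rfl, rfl⟩)
    have h1 : m 1 + m 2 + m 3 = l 1 + l 2 + l 3 := by
      rcases h with ⟨h, h', h''⟩ | ⟨h, h', h''⟩ | ⟨h, h', h''⟩ <;> rw [h, h', h''] <;> ring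
    have h2 : entryB₄ m g = entryB₄ l g := by
      rw [entryB₄, entryB₄, h0]
      rcases h with ⟨h, h', h''⟩ | ⟨h, h', h''⟩ | ⟨h, h', h''⟩ <;> rw [h, h', h''] <;> ring
    simp only [modelC, modelS, modelT, h0, h1, h2, true_and]
  · have h : m 1 = l 1 ∧ m 2 = l 2 ∧ m 3 = l 3 ∧ m 4 = l 4 ∨
        m 1 = l 2 ∧ m 2 = l 1 ∧ m 3 = l 3 ∧ m 4 = l 4 ∨
        m 1 = l 3 ∧ m 2 = l 2 ∧ m 3 = l 1 ∧ m 4 = l 4 ∨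
        m 1 = l 4 ∧ m 2 = l 2 ∧ m 3 = l 3 ∧ m 4 = l 1 := by
      rw [hm]
      fin_cases s
      · exact absurd rfl hs
      · exact Or.inl ⟨rfl, rfl, rfl, rfl⟩
      · exact Or.inr (Or.inl ⟨rfl, rfl, rfl, rfl⟩)
      · exact Or.inr (Or.inr (Or.inl ⟨rfl, rfl, rfl, rfl⟩))
      · exact Or.inr (Or.inr (Or.inr ⟨rfl, rfl, rfl, rfl⟩))
    have he : entryE₅ m g = entryE₅ l g := by
      rw [entryE₅, entryE₅, h0]
      rcases h with ⟨a, b, c, d⟩ | ⟨a, b, c, d⟩ | ⟨a, b, c, d⟩ | ⟨a, b, c, d⟩ <;>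
        rw [a, b, c, d] <;> ring
    have ha : entryA₅ m g = entryA₅ l g := by
      rw [entryA₅, entryA₅, he]
      rcases h with ⟨a, b, c, d⟩ | ⟨a, b, c, d⟩ | ⟨a, b, c, d⟩ | ⟨a, b, c, d⟩ <;>
        rw [a, b, c, d] <;> ring
    have hb : entryB₅ m g = entryB₅ l g := by
      rw [entryB₅, entryB₅, ha, h0]
      rcases h with ⟨a, b, c, d⟩ | ⟨a, b, c, d⟩ | ⟨a, b, c, d⟩ | ⟨a, b, c, d⟩ <;>
        rw [a, b, c, d] <;> ring
    simp only [modelC, modelS, modelT, h0, he, ha, hb, true_and]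

end Identity

/-! ### The group B₃ in terms of δ and τ -/

section Braid

/-- The half twist `σ₁σ₂σ₁`. -/
def δ : B3 := σ₁ * σ₂ * σ₁

/-- The element `σ₁σ₂`. -/
def τ : B3 := σ₁ * σ₂

theorem braid_rel : σ₁ * σ₂ * σ₁ = σ₂ * σ₁ * σ₂ := by
  have h := PresentedGroup.one_of_mem (rels := braidRelators) (Set.mem_singleton _)
  simp only [map_mul, map_inv] at h
  exact mul_inv_eq_one.1 h

theorem τ_mul_σ₁ : τ * σ₁ = δ := rfl

theorem σ₂_mul_τ : σ₂ * τ = δ := by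
  rw [δ, braid_rel, τ, mul_assoc]

theorem δ_mul_σ₁ : δ * σ₁ = σ₂ * δ := by
  rw [← σ₂_mul_τ, mul_assoc, τ_mul_σ₁, σ₂_mul_τ]

theorem δ_mul_δ : δ * δ = ζ := by
  have h : δ * δ = τ * (σ₁ * σ₂) * τ := by
    rw [← σ₂_mul_τ, ← mul_assoc, σ₂_mul_τ, ← τ_mul_σ₁, mul_assoc τ]
  rw [h, ζ, ← τ, pow_succ, pow_two]

theorem τ_mul_τ_mul_τ : τ * (τ * τ) = ζ := by
  rw [ζ, ← τ, pow_succ, pow_two, mul_assoc]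

/-- Since σ₁ = τ⁻¹δ and σ₂ = δτ⁻¹, the elements δ and τ generate the group. -/
theorem mem_of_δ_mem_of_τ_mem {H : Subgroup B3} (hδ : δ ∈ H) (hτ : τ ∈ H) (g : B3) : g ∈ H := by
  refine PresentedGroup.generated_by _ H (fun j => ?_) g
  fin_cases j
  · change σ₁ ∈ H
    rw [show σ₁ = τ⁻¹ * δ by rw [← τ_mul_σ₁, inv_mul_cancel_left]]
    exact H.mul_mem (H.inv_mem hτ) hδ
  · change σ₂ ∈ H
    rw [show σ₂ = δ * τ⁻¹ by rw [← σ₂_mul_τ, mul_inv_cancel_right]]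
    exact H.mul_mem hδ (H.inv_mem hτ)

/-- ζ is a power of δ and also a power of τ, so it commutes with both generators. -/
theorem commute_ζ (g : B3) : Commute ζ g := by
  have h : g ∈ Subgroup.centralizer {ζ} := by
    refine mem_of_δ_mem_of_τ_mem ?_ ?_ g <;> rw [Subgroup.mem_centralizer_singleton_iff]
    · rw [← δ_mul_δ, mul_assoc]
    · rw [← τ_mul_τ_mul_τ, mul_assoc, mul_assoc]
  exact (Subgroup.mem_centralizer_singleton_iff.1 h).symm

/-- The homomorphism from `B3` that maps `σ₁σ₂σ₁` and `σ₁σ₂` to elements `s`, `t` with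
`s ^ 2 = t ^ 3`. -/
def liftPair {G : Type*} [Group G] (s t : G) (h : s * s = t * (t * t)) : B3 →* G :=
  PresentedGroup.toGroup (f := ![t⁻¹ * s, s * t⁻¹]) <| by
    rintro _ rfl
    simp only [map_mul, map_inv, FreeGroup.lift_apply_of, Matrix.cons_val_zero,
      Matrix.cons_val_one, mul_inv_eq_one]
    -- Both sides of the braid relation equal s as soon as s² = t³.
    calc t⁻¹ * s * (s * t⁻¹) * (t⁻¹ * s) = t⁻¹ * (s * s) * t⁻¹ * t⁻¹ * s := by group
      _ = s := by rw [h]; group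
      _ = s * t⁻¹ * t⁻¹ * (t * (t * t)) * t⁻¹ := by group
      _ = s * t⁻¹ * (t⁻¹ * s) * (s * t⁻¹) := by rw [← h]; group

theorem liftPair_σ₁ {G : Type*} [Group G] (s t : G) (h : s * s = t * (t * t)) :
    liftPair s t h σ₁ = t⁻¹ * s := PresentedGroup.toGroup.of _

theorem liftPair_σ₂ {G : Type*} [Group G] (s t : G) (h : s * s = t * (t * t)) :
    liftPair s t h σ₂ = s * t⁻¹ := PresentedGroup.toGroup.of _

theorem liftPair_τ {G : Type*} [Group G] (s t : G) (h : s * s = t * (t * t)) :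
    liftPair s t h τ = t := by
  rw [τ, map_mul, liftPair_σ₁, liftPair_σ₂]
  calc t⁻¹ * s * (s * t⁻¹) = t⁻¹ * (s * s) * t⁻¹ := by group
    _ = t := by rw [h]; group

theorem liftPair_δ {G : Type*} [Group G] (s t : G) (h : s * s = t * (t * t)) :
    liftPair s t h δ = s := by
  rw [← τ_mul_σ₁, map_mul, liftPair_τ, liftPair_σ₁, mul_inv_cancel_left]

end Braid

/-! ### From representations of B₃ to simple pairs -/

section Representation

variable {K V W : Type*} [Field K] [AddCommGroup V] [Module K V] [AddCommGroup W] [Module K W]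

/-- The map φ is later taken to be δ (which conjugates σ₁ to σ₂), an equivalence of modules, the
inclusion of a submodule, or a quotient map. -/
theorem map_aeval_apply {f : Module.End K V} {g : Module.End K W} {φ : V →ₗ[K] W}
    (h : ∀ v, φ (f v) = g (φ v)) (q : K[X]) (v : V) : φ (aeval f q v) = aeval g q (φ v) := by
  induction q using Polynomial.induction_on' generalizing v with
  | add p q hp hq => simp [hp, hq]
  | monomial n a =>
    have h' : ∀ n v, φ ((f ^ n) v) = (g ^ n) (φ v) := by
      intro n
      induction n with
      | zero => simp
      | succ n ih => intro v; rw [pow_succ, pow_succ, Module.End.mul_apply, ih, h]; rfl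
    simp [aeval_monomial, h']

theorem aeval_apply_eq_zero_of_dvd {f : Module.End K V} {q q' : K[X]} (h : q ∣ q')
    (hq : aeval f q = 0) : aeval f q' = 0 := by
  obtain ⟨r, rfl⟩ := h
  rw [map_mul, hq, zero_mul]

variable (ρ : Representation K B3 V)

theorem apply_τ_apply_σ₁ (v : V) : ρ τ (ρ σ₁ v) = ρ δ v := by
  rw [← τ_mul_σ₁, map_mul, Module.End.mul_apply]

theorem apply_δ_apply_σ₁ (v : V) : ρ δ (ρ σ₁ v) = ρ σ₂ (ρ δ v) := by
  rw [← Module.End.mul_apply, ← map_mul, δ_mul_σ₁, map_mul, Module.End.mul_apply]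

theorem apply_δ_apply_δ (v : V) : ρ δ (ρ δ v) = ρ ζ v := by
  rw [← Module.End.mul_apply, ← map_mul, δ_mul_δ]

theorem apply_τ_apply_τ_apply_τ (v : V) : ρ τ (ρ τ (ρ τ v)) = ρ ζ v := by
  rw [← Module.End.mul_apply, ← Module.End.mul_apply, ← map_mul, ← map_mul, mul_assoc, τ_mul_τ_mul_τ]

theorem apply_injective (g : B3) : Function.Injective (ρ g) := by
  intro v w h
  have := congrArg (ρ g⁻¹) h
  simpa [← Module.End.mul_apply, ← map_mul] using this

theorem apply_δ_aeval_σ₁ (q : K[X]) (v : V) :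
    ρ δ (aeval (ρ σ₁) q v) = aeval (ρ σ₂) q (ρ δ v) :=
  map_aeval_apply (apply_δ_apply_σ₁ ρ) q v

theorem σ₁_apply_eq_smul_iff {l : K} {v : V} : ρ σ₁ v = l • v ↔ ρ δ v = l • ρ τ v := by
  rw [← apply_τ_apply_σ₁, ← map_smul, (apply_injective ρ τ).eq_iff]

/-- As τσ₁ = δ, one has xT - S = T(x - σ₁). This turns the eigenvalues of σ₁ into a condition on the
pair. -/
theorem det_sub_eq [FiniteDimensional K V] (x : K) :
    LinearMap.det (x • ρ τ - ρ δ) = LinearMap.det (ρ τ) * (ρ σ₁).charpoly.eval x := by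
  rw [LinearMap.eval_charpoly, ← LinearMap.det_comp]
  congr 1
  ext v
  simp [apply_τ_apply_σ₁]

variable {ρ}

/-- A linear equivalence that intertwines the actions of `σ₁σ₂σ₁` and `σ₁σ₂` is an equivalence of
representations. -/
theorem nonempty_equiv {ρ' : Representation K B3 W} (e : V ≃ₗ[K] W)
    (hδ : ∀ v, e (ρ δ v) = ρ' δ (e v)) (hτ : ∀ v, e (ρ τ v) = ρ' τ (e v)) :
    Nonempty (ρ.Equiv ρ') := by
  let H : Subgroup B3 :=
    { carrier := {g | ∀ v, e (ρ g v) = ρ' g (e v)}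
      mul_mem' := by
        intro a b ha hb v
        simp only [Set.mem_ofPred_eq] at ha hb
        rw [map_mul, map_mul, Module.End.mul_apply, ha, hb, Module.End.mul_apply]
      one_mem' := by simp
      inv_mem' := by
        intro a ha v
        apply apply_injective ρ' a
        rw [← ha]
        simp [← Module.End.mul_apply, ← map_mul] }
  have h : ∀ g : B3, g ∈ H := mem_of_δ_mem_of_τ_mem hδ hτ
  exact ⟨.mk e fun g => LinearMap.ext fun v => h g v⟩

/-- With ζ = c ≠ 0 the inverses are c⁻¹δ and c⁻¹τ², so stability under δ and τ alone gives stability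
under the group. -/
theorem apply_mem_of_apply_ζ {c : K} (hc : c ≠ 0) (hζ : ∀ v, ρ ζ v = c • v) {N : Submodule K V}
    (hδ : ∀ v ∈ N, ρ δ v ∈ N) (hτ : ∀ v ∈ N, ρ τ v ∈ N) (g : B3) {v : V} (hv : v ∈ N) :
    ρ g v ∈ N := by
  have hinv : ∀ a : B3, ∀ v w, ρ a w = c • v → ρ a⁻¹ v = c⁻¹ • w := by
    intro a v w h
    apply apply_injective ρ a
    rw [map_smul, h, smul_smul, inv_mul_cancel₀ hc, one_smul]
    simp [← Module.End.mul_apply, ← map_mul]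
  let H : Subgroup B3 :=
    { carrier := {g | ∀ v ∈ N, ρ g v ∈ N ∧ ρ g⁻¹ v ∈ N}
      mul_mem' := by
        intro a b ha hb v hv
        rw [mul_inv_rev, map_mul, map_mul, Module.End.mul_apply, Module.End.mul_apply]
        exact ⟨(ha _ (hb v hv).1).1, (hb _ (ha v hv).2).2⟩
      one_mem' := by intro v hv; simpa using hv
      inv_mem' := by
        intro a ha v hv
        rw [inv_inv]
        exact (ha v hv).symm }
  have h : ∀ g : B3, g ∈ H := by
    refine mem_of_δ_mem_of_τ_mem (fun v hv => ⟨hδ v hv, ?_⟩) (fun v hv => ⟨hτ v hv, ?_⟩)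
    · rw [hinv δ v (ρ δ v) (by rw [apply_δ_apply_δ, hζ])]
      exact N.smul_mem _ (hδ v hv)
    · rw [hinv τ v (ρ τ (ρ τ v)) (by rw [apply_τ_apply_τ_apply_τ, hζ])]
      exact N.smul_mem _ (hτ _ (hτ v hv))
  exact (h g v hv).1

theorem eq_bot_or_eq_top_of_isIrreducible (h : ρ.IsIrreducible) (N : Submodule K V)
    (hN : ∀ g, ∀ v ∈ N, ρ g v ∈ N) : N = ⊥ ∨ N = ⊤ :=
  (h.eq_bot_or_eq_top ⟨N, fun g v hv => hN g v hv⟩).imp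
    (congrArg Subrepresentation.toSubmodule) (congrArg Subrepresentation.toSubmodule)

theorem nontrivial_of_isIrreducible (h : ρ.IsIrreducible) : Nontrivial V := by
  by_contra hV
  rw [not_nontrivial_iff_subsingleton] at hV
  exact bot_ne_top (α := Subrepresentation ρ)
    (Subrepresentation.toSubmodule_injective (Subsingleton.elim _ _))

theorem isIrreducible_of_forall [Nontrivial V]
    (h : ∀ N : Submodule K V, (∀ g, ∀ v ∈ N, ρ g v ∈ N) → N = ⊥ ∨ N = ⊤) : ρ.IsIrreducible where
  exists_pair_ne := ⟨⊥, ⊤, fun h =>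
    bot_ne_top (α := Submodule K V) (congrArg Subrepresentation.toSubmodule h)⟩
  eq_bot_or_eq_top N := (h N.toSubmodule fun g _ hv => N.apply_mem_toSubmodule g hv).imp
    (fun h => Subrepresentation.toSubmodule_injective h)
    (fun h => Subrepresentation.toSubmodule_injective h)

/-- Schur's lemma: an eigenspace of the central element ζ is a nonzero submodule, hence everything.
-/
theorem exists_isSimplePair [IsAlgClosed K] [FiniteDimensional K V] (h : ρ.IsIrreducible) :
    ∃ c : K, ρ ζ = c • (1 : Module.End K V) ∧ IsSimplePair c (ρ δ) (ρ τ) := by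
  have := nontrivial_of_isIrreducible h
  obtain ⟨c, hc⟩ := Module.End.exists_eigenvalue (ρ ζ)
  have hζ : ∀ v, ρ ζ v = c • v := by
    have hN := (eq_bot_or_eq_top_of_isIrreducible h (Module.End.eigenspace (ρ ζ) c) ?_).resolve_left
      hc
    · intro v
      exact Module.End.mem_eigenspace_iff.1 (hN ▸ Submodule.mem_top)
    · intro g v hv
      rw [Module.End.mem_eigenspace_iff] at hv ⊢
      rw [← Module.End.mul_apply, ← map_mul, (commute_ζ g).eq, map_mul, Module.End.mul_apply, hv,
        map_smul]
  have hc0 : c ≠ 0 := by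
    rintro rfl
    obtain ⟨v, hv⟩ := exists_ne (0 : V)
    exact hv (apply_injective ρ ζ (by rw [hζ, zero_smul, map_zero]))
  refine ⟨c, LinearMap.ext hζ, hc0, fun v => ?_, fun v => ?_, fun N hδ hτ => ?_⟩
  · rw [apply_δ_apply_δ, hζ]
  · rw [apply_τ_apply_τ_apply_τ, hζ]
  · exact eq_bot_or_eq_top_of_isIrreducible h N fun g v hv => apply_mem_of_apply_ζ hc0 hζ hδ hτ g hv

end Representation

/-! ### The model as a representation -/

section ModelRepresentation

variable {K : Type*} [Field K]

/-- An operator whose square is a nonzero scalar, as a unit. -/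
def unitOfSq {R : Type*} [Ring R] [Algebra K R] (s : R) {c : K} (hc : c ≠ 0)
    (h : s * s = c • 1) : Rˣ where
  val := s
  inv := c⁻¹ • s
  val_inv := by rw [mul_smul_comm, h, smul_smul, inv_mul_cancel₀ hc, one_smul]
  inv_val := by rw [smul_mul_assoc, h, smul_smul, inv_mul_cancel₀ hc, one_smul]

/-- An operator whose cube is a nonzero scalar, as a unit. -/
def unitOfCube {R : Type*} [Ring R] [Algebra K R] (t : R) {c : K} (hc : c ≠ 0)
    (h : t * (t * t) = c • 1) : Rˣ where
  val := t
  inv := c⁻¹ • (t * t)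
  val_inv := by rw [mul_smul_comm, h, smul_smul, inv_mul_cancel₀ hc, one_smul]
  inv_val := by rw [smul_mul_assoc, mul_assoc, h, smul_smul, inv_mul_cancel₀ hc, one_smul]

variable {d : ℕ} {p : Param K d}

/-- The representation of `B3` on `K ^ d` with a given parameter. -/
noncomputable def modelRep (hp : p ∈ paramSpace K d) : Representation K B3 (Fin d → K) :=
  ((Matrix.toLinAlgEquiv' : Matrix (Fin d) (Fin d) K ≃ₐ[K] _) :
    Matrix (Fin d) (Fin d) K →* Module.End K (Fin d → K)).comp <| (Units.coeHom _).comp <|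
      liftPair (unitOfSq (modelS p) (modelC_ne_zero hp) (modelS_sq hp))
        (unitOfCube (modelT p) (modelC_ne_zero hp) (modelT_cube p))
        (Units.ext ((modelS_sq hp).trans (modelT_cube p).symm))

theorem modelRep_δ (hp : p ∈ paramSpace K d) :
    modelRep hp δ = Matrix.toLinAlgEquiv' (modelS p) := by
  simp only [modelRep, MonoidHom.comp_apply, liftPair_δ]
  rfl

theorem modelRep_τ (hp : p ∈ paramSpace K d) :
    modelRep hp τ = Matrix.toLinAlgEquiv' (modelT p) := by
  simp only [modelRep, MonoidHom.comp_apply, liftPair_τ]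
  rfl

theorem modelRep_ζ (hp : p ∈ paramSpace K d) : modelRep hp ζ = modelC p • 1 := by
  rw [← δ_mul_δ, map_mul, modelRep_δ, ← map_mul, modelS_sq hp, map_smul, map_one]

theorem modelRep_σ₂ (hp : p ∈ paramSpace K d) :
    modelRep hp σ₂ = Matrix.toLinAlgEquiv' (modelB p) := by
  have h : modelRep hp σ₂ * modelRep hp τ = Matrix.toLinAlgEquiv' (modelB p) * modelRep hp τ := by
    rw [← map_mul, σ₂_mul_τ, modelRep_τ, modelRep_δ, ← map_mul, modelB_mul hp]
  have h' : modelRep hp τ * modelRep hp τ⁻¹ = 1 := by rw [← map_mul, mul_inv_cancel, map_one]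
  rw [← mul_one (modelRep hp σ₂), ← h', ← mul_assoc, h, mul_assoc, h', mul_one]

theorem modelRep_congr {q : Param K d} (hp : p ∈ paramSpace K d) (hq : q ∈ paramSpace K d)
    (hS : modelS q = modelS p) (hT : modelT q = modelT p) : modelRep hq = modelRep hp := by
  have h : ∀ g, g ∈ (modelRep hq).eqLocus (modelRep hp) := by
    refine mem_of_δ_mem_of_τ_mem ?_ ?_
    · change modelRep hq δ = modelRep hp δ
      rw [modelRep_δ, modelRep_δ, hS]
    · change modelRep hq τ = modelRep hp τ
      rw [modelRep_τ, modelRep_τ, hT]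
  exact MonoidHom.ext h

theorem charpoly_modelRep [Infinite K] (hd1 : 1 ≤ d) (hd5 : d ≤ 5) (hp : p ∈ paramSpace K d) :
    (modelRep hp σ₁).charpoly = ∏ i, (X - C (p.1 i)) := by
  refine Polynomial.funext fun x => ?_
  have h := det_sub_eq (modelRep hp) x
  have hτ : LinearMap.det (modelRep hp τ) ≠ 0 := by
    have := LinearMap.isUnit_det (modelRep hp τ)
      (IsUnit.of_mul_eq_one (modelRep hp τ⁻¹) (by rw [← map_mul, mul_inv_cancel, map_one]))
    exact this.ne_zero
  have hdet : ∀ M : Matrix (Fin d) (Fin d) K,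
      LinearMap.det (Matrix.toLinAlgEquiv' M : Module.End K (Fin d → K)) = M.det :=
    fun M => LinearMap.det_toLin' M
  refine mul_left_cancel₀ hτ (h.symm.trans ?_)
  rw [modelRep_τ, modelRep_δ, ← map_smul, ← map_sub, hdet, hdet, det_model hd1 hd5 hp, eval_prod]
  simp

theorem hasParam_modelRep [Infinite K] (hd1 : 1 ≤ d) (hd5 : d ≤ 5) (hp : p ∈ paramSpace K d) :
    HasParam (modelRep hp) p where
  charpoly_eq := charpoly_modelRep hd1 hd5 hp
  mem := hp
  central := by
    match d, p, hp with
    | 0, _, _ | 1, _, _ | 2, _, _ | 3, _, _ | _ + 6, _, _ => trivial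
    | 4, (l, g), hp => exact modelRep_ζ hp
    | 5, (l, g), hp => exact modelRep_ζ hp

end ModelRepresentation

/-! ### Existence and uniqueness of the parameter -/

section Parameter

variable {K : Type*} [Field K] {d : ℕ}

/-- Equal root multiplicities mean that l and m have fibres of equal size over every value;
bijections between the fibres glue to a permutation. -/
theorem exists_perm_of_prod_eq {l m : Fin d → K}
    (h : ∏ i, (X - C (l i)) = ∏ i, (X - C (m i))) : ∃ π : Equiv.Perm (Fin d), m = l ∘ π := by
  classical
  have hroots : ∀ l : Fin d → K, (∏ i, (X - C (l i))).roots = Finset.univ.val.map l := by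
    intro l
    rw [← roots_multiset_prod_X_sub_C (Finset.univ.val.map l), Multiset.map_map]
    rfl
  have hcard : ∀ (l : Fin d → K) (a : K),
      Fintype.card {i // l i = a} = (∏ i, (X - C (l i))).roots.count a := by
    intro l a
    rw [hroots, Multiset.count_map, Fintype.card_subtype, Finset.card_def, Finset.filter_val]
    simp only [eq_comm]
  let e : ∀ a, {i // m i = a} ≃ {i // l i = a} := fun a =>
    Fintype.equivOfCardEq (by rw [hcard, hcard, h])
  exact ⟨Equiv.ofFiberEquiv e, funext fun i => (Equiv.ofFiberEquiv_map e i).symm⟩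

theorem exists_prod_eq_of_monic [IsAlgClosed K] {f : K[X]} (hf : f.Monic) (hd : f.natDegree = d) :
    ∃ l : Fin d → K, f = ∏ i, (X - C (l i)) := by
  have hs := IsAlgClosed.splits f
  have hcard : f.roots.toList.length = d := by
    rw [Multiset.length_toList, ← hs.natDegree_eq_card_roots, hd]
  subst hcard
  refine ⟨f.roots.toList.get, ?_⟩
  conv_lhs => rw [hs.eq_prod_roots_of_monic hf, ← Multiset.coe_toList f.roots]
  rw [Multiset.map_coe, Multiset.prod_coe, ← List.prod_ofFn]
  congr 1
  apply List.ext_getElem <;> simp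

theorem prod_comp_perm {α M : Type*} [CommMonoid M] (f : α → M) (l : Fin d → α)
    (π : Equiv.Perm (Fin d)) : ∏ i, f ((l ∘ π) i) = ∏ i, f (l i) :=
  Equiv.prod_comp π fun i => f (l i)

theorem comp_perm_mem_paramSpace {p : Param K d} (hp : p ∈ paramSpace K d)
    (π : Equiv.Perm (Fin d)) : (p.1 ∘ π, p.2) ∈ paramSpace K d := by
  refine ⟨fun i => hp.1 (π i), ?_⟩
  have h := hp.2
  match d, p, π, h with
  | 0, _, _, h | 1, _, _, h | 2, _, _, h | 3, _, _, h | _ + 6, _, _, h => exact h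
  | 4, (l, g), π, h => exact h.trans (prod_comp_perm id l π).symm
  | 5, (l, g), π, h => exact h.trans (prod_comp_perm id l π).symm

theorem CentralCondition.of_snd_eq {V : Type*} [AddCommGroup V] [Module K V]
    {ρ : Representation K B3 V} {p q : Param K d} (h : CentralCondition ρ p) (hpq : q.2 = p.2) :
    CentralCondition ρ q := by
  obtain ⟨l, g⟩ := p
  obtain ⟨m, g'⟩ := q
  obtain rfl : g' = g := hpq
  match d, l, m, h with
  | 0, _, _, _ | 1, _, _, _ | 2, _, _, _ | 3, _, _, _ | _ + 6, _, _, _ => trivial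
  | 4, _, _, h => exact h
  | 5, _, _, h => exact h

variable {V W : Type*} [AddCommGroup V] [Module K V] [FiniteDimensional K V] [AddCommGroup W]
  [Module K W] [FiniteDimensional K W] {ρ : Representation K B3 V} {ρ' : Representation K B3 W}
  {p q : Param K d}

theorem HasParam.comp_perm (h : HasParam ρ p) (π : Equiv.Perm (Fin d)) :
    HasParam ρ (p.1 ∘ π, p.2) where
  charpoly_eq := h.charpoly_eq.trans (prod_comp_perm (fun a => X - C a) p.1 π).symm
  mem := comp_perm_mem_paramSpace h.mem π
  central := h.central.of_snd_eq rfl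

theorem HasParam.of_equiv (h : HasParam ρ p) (e : ρ.Equiv ρ') : HasParam ρ' p where
  charpoly_eq := by
    rw [← h.charpoly_eq, ← e.conj_apply_self, LinearEquiv.charpoly_conj]
  mem := h.mem
  central := by
    have hc := h.central
    match d, p, hc with
    | 0, _, _ | 1, _, _ | 2, _, _ | 3, _, _ | _ + 6, _, _ => trivial
    | 4, (l, g), hc =>
      change ρ' ζ = _
      rw [← e.conj_apply_self, show ρ ζ = _ from hc, map_smul]
      exact congrArg _ (LinearEquiv.conj_id _)
    | 5, (l, g), hc =>
      change ρ' ζ = _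
      rw [← e.conj_apply_self, show ρ ζ = _ from hc, map_smul]
      exact congrArg _ (LinearEquiv.conj_id _)

theorem HasParam.finrank_eq (h : HasParam ρ p) : Module.finrank K V = d := by
  rw [← LinearMap.charpoly_natDegree (ρ σ₁), h.charpoly_eq, natDegree_finsetProd_X_sub_C_eq_card,
    Finset.card_univ, Fintype.card_fin]

/-- Two parameters have the same product of eigenvalues and the same action of ζ. So g² and g³ agree
for d = 4, and g⁵ and g⁶ for d = 5; the nonzero product of the eigenvalues can be cancelled, leaving
g. -/
theorem HasParam.snd_eq [Nontrivial V] (hp : HasParam ρ p) (hq : HasParam ρ q) : q.2 = p.2 := by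
  obtain ⟨π, hπ⟩ := exists_perm_of_prod_eq (hp.charpoly_eq.symm.trans hq.charpoly_eq)
  have hprod : ∏ i, q.1 i = ∏ i, p.1 i := by
    rw [hπ]
    exact prod_comp_perm id p.1 π
  have hne : ∏ i, p.1 i ≠ 0 := Finset.prod_ne_zero_iff.2 fun i _ => hp.mem.1 i
  have hinj : Function.Injective fun c : K => c • (1 : Module.End K V) :=
    smul_left_injective K one_ne_zero
  clear hπ π
  obtain ⟨-, ⟨-, hp⟩, hpc⟩ := hp
  obtain ⟨-, ⟨-, hq⟩, hqc⟩ := hq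
  match d, p, q with
  | 0, _, _ | 1, _, _ | 2, _, _ | 3, _, _ | _ + 6, _, _ => exact Eq.trans hq (Eq.symm hp)
  | 4, (l, g), (m, g') =>
    have h : -g' ^ 3 = -g ^ 3 := hinj (hqc.symm.trans hpc)
    change g ^ 2 = _ at hp
    change g' ^ 2 = _ at hq
    change g' = g
    refine mul_right_cancel₀ hne ?_
    simp only at hprod
    rw [← hp]
    linear_combination -h - g' * (hq.trans (hprod.trans hp.symm))
  | 5, (l, g), (m, g') =>
    have h : g' ^ 6 = g ^ 6 := hinj (hqc.symm.trans hpc)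
    change g ^ 5 = _ at hp
    change g' ^ 5 = _ at hq
    change g' = g
    refine mul_right_cancel₀ hne ?_
    simp only at hprod
    rw [← hp]
    linear_combination h - g' * (hq.trans (hprod.trans hp.symm))

theorem HasParam.iff_sameOrbit [Nontrivial V] (hp : HasParam ρ p) :
    HasParam ρ q ↔ SameOrbit p q := by
  constructor
  · intro hq
    obtain ⟨π, hπ⟩ := exists_perm_of_prod_eq (hp.charpoly_eq.symm.trans hq.charpoly_eq)
    exact ⟨π, hπ, hp.snd_eq hq⟩
  · rintro ⟨π, h1, h2⟩
    obtain ⟨l, g⟩ := q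
    obtain rfl : l = _ := h1
    obtain rfl : g = _ := h2
    exact hp.comp_perm π

variable [IsAlgClosed K]

/-- The listing l of the eigenvalues is arbitrary, while g is produced by the normal form.
Uniqueness of g later identifies it with a prescribed one. -/
theorem exists_equiv_modelRep (hρ : ρ.IsIrreducible) (hd1 : 1 ≤ d) (hd5 : d ≤ 5)
    (hd : Module.finrank K V = d) {l : Fin d → K}
    (hl : (ρ σ₁).charpoly = ∏ i, (X - C (l i))) :
    ∃ (g : K) (hp : (l, g) ∈ paramSpace K d), Nonempty (ρ.Equiv (modelRep hp)) := by
  have : Infinite K := IsAlgClosed.instInfinite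
  obtain ⟨c, -, h⟩ := exists_isSimplePair hρ
  obtain ⟨g, hp, -, B, hS, hT⟩ := h.exists_model_basis hd1 hd5 hd l fun x => by
    rw [det_sub_eq, hl, eval_prod]
    simp
  refine ⟨g, hp, nonempty_equiv B.equivFun (fun v => ?_) fun v => ?_⟩
  · rw [modelRep_δ, Matrix.toLinAlgEquiv'_apply, ← hS]
    exact (LinearMap.toMatrix_mulVec_repr B B _ v).symm
  · rw [modelRep_τ, Matrix.toLinAlgEquiv'_apply, ← hT]
    exact (LinearMap.toMatrix_mulVec_repr B B _ v).symm

theorem exists_hasParam (hρ : ρ.IsIrreducible) (hd1 : 1 ≤ d) (hd5 : d ≤ 5)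
    (hd : Module.finrank K V = d) : ∃ p : Param K d, HasParam ρ p := by
  have : Infinite K := IsAlgClosed.instInfinite
  obtain ⟨l, hl⟩ := exists_prod_eq_of_monic (LinearMap.charpoly_monic (ρ σ₁))
    ((LinearMap.charpoly_natDegree _).trans hd)
  obtain ⟨g, hp, ⟨e⟩⟩ := exists_equiv_modelRep hρ hd1 hd5 hd hl
  exact ⟨(l, g), (hasParam_modelRep hd1 hd5 hp).of_equiv e.symm⟩

theorem HasParam.nonempty_equiv_modelRep (hρ : ρ.IsIrreducible) (hd1 : 1 ≤ d) (hd5 : d ≤ 5)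
    (h : HasParam ρ p) : Nonempty (ρ.Equiv (modelRep h.mem)) := by
  have : Infinite K := IsAlgClosed.instInfinite
  have := nontrivial_of_isIrreducible hρ
  obtain ⟨g, hp, ⟨e⟩⟩ := exists_equiv_modelRep hρ hd1 hd5 h.finrank_eq h.charpoly_eq
  obtain ⟨l, g'⟩ := p
  obtain rfl : g = g' := h.snd_eq ((hasParam_modelRep hd1 hd5 hp).of_equiv e.symm)
  exact ⟨e⟩

end Parameter

/-! ### Symmetry of P and Q, and the zeros of Q against the excluded locus -/

section Symmetry

variable {K : Type*} [Field K] {d : ℕ}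

theorem P_comp_perm (l : Fin d → K) (π : Equiv.Perm (Fin d)) (r : Fin d) :
    P (l ∘ π) r = P l (π r) :=
  Finset.prod_equiv π (by simp) (by simp)

theorem X_sub_C_mul_P (l : Fin d → K) (r : Fin d) :
    (X - C (l r)) * P l r = ∏ i, (X - C (l i)) :=
  Finset.mul_prod_erase Finset.univ (fun i => X - C (l i)) (Finset.mem_univ r)

theorem Q_comp_perm (p : Param K d) (π : Equiv.Perm (Fin d)) (r s : Fin d) :
    Q (p.1 ∘ π, p.2) r s = Q p (π r) (π s) := by
  match d, p, π, r, s with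
  | 0, _, _, _, _ | 1, _, _, _, _ | 2, _, _, _, _ | _ + 6, _, _, _, _ => rfl
  | 3, (l, g), π, r, s =>
    simp only [Q]
    exact Finset.prod_equiv π (by simp) (by simp)
  | 4, (l, g), π, r, s =>
    simp only [Q]
    congr 1
    exact Finset.prod_equiv (π.prodCongr π) (by simp) (by simp)
  | 5, (l, g), π, r, s =>
    simp only [Q]
    congr 1
    exact Finset.prod_equiv π (by simp) (by simp)

theorem exists_perm_apply {n : ℕ} {r s : Fin (n + 2)} (h : r ≠ s) :
    ∃ π : Equiv.Perm (Fin (n + 2)), π 0 = r ∧ π 1 = s := by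
  -- The second swap sends the image of 1 to s and fixes r, which is neither that image nor s.
  refine ⟨(Equiv.swap 0 r).trans (Equiv.swap (Equiv.swap 0 r 1) s), ?_, by simp⟩
  rw [Equiv.trans_apply, Equiv.swap_apply_left, Equiv.swap_apply_of_ne_of_ne _ h]
  intro h'
  have := congrArg (Equiv.swap 0 r) h'
  simp at this

theorem exists_Q_eq_zero_of_isExcluded {p : Param K d} (h : IsExcluded p) :
    ∃ r s, r ≠ s ∧ Q p r s = 0 := by
  match d, p, h with
  | 2, (l, g), h =>
    refine ⟨0, 1, by decide, ?_⟩
    simp only [IsExcluded, Q] at h ⊢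
    linear_combination -h
  | 3, (l, g), ⟨i, r, s, hir, his, hrs, h⟩ =>
    refine ⟨i, r, hir, ?_⟩
    exact Finset.prod_eq_zero (i := s) (by simp [his.symm, hrs.symm]) (by rw [h, zero_mul])
  | 4, (l, g), .inl ⟨i, h⟩ =>
    obtain ⟨s, hs⟩ := exists_ne i
    exact ⟨i, s, hs.symm, by simp [Q, h]⟩
  | 4, (l, g), .inr ⟨i, j, r, s, hd, h⟩ =>
    simp only [List.nodup_cons, List.mem_cons, List.not_mem_nil, or_false, not_or] at hd
    obtain ⟨⟨hij, hir, his⟩, ⟨hjr, hjs⟩, hrs, -⟩ := hd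
    -- The factor pairing i with j and r with s occurs in Q at (i, r), not at (i, j).
    refine ⟨i, r, hir, mul_eq_zero_of_right _ ?_⟩
    exact Finset.prod_eq_zero (i := (j, s))
      (by simp [Ne.symm hij, hjr, Ne.symm his, Ne.symm hrs, hjs]) h
  | 5, (l, g), .inl ⟨i, h⟩ =>
    obtain ⟨s, hs⟩ := exists_ne i
    refine ⟨i, s, hs.symm, ?_⟩
    simp only [Q]
    rw [show g ^ 2 + l i * g + l i ^ 2 = 0 by linear_combination h]
    ring
  | 5, (l, g), .inr ⟨i, j, hij, h⟩ =>
    -- The factor g² + λᵢλⱼ does not occur in Q at (i, j), so a third index s is taken and Q at (i,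
    -- s) used.
    obtain ⟨s, hs⟩ : ∃ s, s ∉ ({i, j} : Finset (Fin 5)) := by
      by_contra! hs
      have := Finset.card_le_card (show Finset.univ ⊆ ({i, j} : Finset (Fin 5)) from fun s _ => hs s)
      have := Finset.card_le_two (a := i) (b := j)
      simp at *
      omega
    simp only [Finset.mem_insert, Finset.mem_singleton, not_or] at hs
    refine ⟨i, s, Ne.symm hs.1, mul_eq_zero_of_right _ ?_⟩
    exact Finset.prod_eq_zero (i := j) (by simp [hij.ne', Ne.symm hs.2]) (by rw [h, zero_mul])

theorem isExcluded_of_Q_eq_zero {p : Param K d} (hp : p ∈ paramSpace K d) {r s : Fin d}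
    (hrs : r ≠ s) (h : Q p r s = 0) : IsExcluded p := by
  match d, p, hp, r, s, h with
  | 0, _, _, r, _, _ => exact r.elim0
  | 1, _, _, r, s, _ => exact hrs (Subsingleton.elim _ _)
  | 2, (l, g), _, r, s, h =>
    simp only [IsExcluded, Q] at h ⊢
    fin_cases r <;> fin_cases s
    · exact absurd rfl hrs
    · simp only [Fin.zero_eta, Fin.mk_one] at h
      linear_combination -h
    · simp only [Fin.zero_eta, Fin.mk_one] at h
      linear_combination -h
    · exact absurd rfl hrs
  | 3, (l, g), _, r, s, h =>
    simp only [Q] at h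
    obtain ⟨k, hk, h⟩ := Finset.prod_eq_zero_iff.1 h
    simp only [Finset.mem_compl, Finset.mem_insert, Finset.mem_singleton, not_or] at hk
    rcases mul_eq_zero.1 h with h | h
    · exact ⟨r, s, k, hrs, Ne.symm hk.1, Ne.symm hk.2, h⟩
    · exact ⟨s, r, k, hrs.symm, Ne.symm hk.2, Ne.symm hk.1, h⟩
  | 4, (l, g), hp, r, s, h =>
    have hg : g ≠ 0 := snd_ne_zero_of_four hp
    simp only [Q, mul_eq_zero, neg_eq_zero, inv_eq_zero, hg, false_or] at h
    rcases h with (h | h) | h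
    · exact Or.inl ⟨r, h⟩
    · exact Or.inl ⟨s, h⟩
    · obtain ⟨⟨k, m⟩, hk, h⟩ := Finset.prod_eq_zero_iff.1 h
      simp only [Finset.mem_offDiag, Finset.mem_compl, Finset.mem_insert, Finset.mem_singleton,
        not_or] at hk
      obtain ⟨⟨hkr, hks⟩, ⟨hmr, hms⟩, hkm⟩ := hk
      refine Or.inr ⟨r, k, s, m, ?_, h⟩
      simp [hrs, hks, Ne.symm hkr, Ne.symm hmr, hkm, Ne.symm hms]
  | 5, (l, g), hp, r, s, h =>
    have hg : g ≠ 0 := snd_ne_zero_of_five hp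
    have key : ∀ i j : Fin 5, i ≠ j → g ^ 2 + l i * l j = 0 → IsExcluded (l, g) := by
      intro i j hij h
      rcases lt_or_gt_of_ne hij with hij | hij
      · exact Or.inr ⟨i, j, hij, h⟩
      · exact Or.inr ⟨j, i, hij, by rw [mul_comm]; exact h⟩
    simp only [Q, mul_eq_zero, inv_eq_zero, pow_eq_zero_iff (show 8 ≠ 0 by norm_num), hg,
      false_or] at h
    rcases h with (h | h) | h
    · exact Or.inl ⟨r, by linear_combination h⟩
    · exact Or.inl ⟨s, by linear_combination h⟩
    · obtain ⟨k, hk, h⟩ := Finset.prod_eq_zero_iff.1 h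
      simp only [Finset.mem_compl, Finset.mem_insert, Finset.mem_singleton, not_or] at hk
      rcases mul_eq_zero.1 h with h | h
      · exact key r k (Ne.symm hk.1) h
      · exact key s k (Ne.symm hk.2) h
  | _ + 6, _, _, _, _, h => exact absurd h one_ne_zero

end Symmetry

/-! ### The identity at e₀ in the model representation -/

section ModelIdentity

open scoped Matrix

variable {K : Type*} [Field K] {n : ℕ} {p : Param K (n + 2)}

theorem aeval_toLinAlgEquiv' {d : ℕ} (M : Matrix (Fin d) (Fin d) K) (q : K[X]) (v : Fin d → K) :
    aeval (Matrix.toLinAlgEquiv' M : Module.End K (Fin d → K)) q v = aeval M q *ᵥ v := by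
  rw [← Matrix.toLinAlgEquiv'_apply]
  congr 1
  exact aeval_algHom_apply (Matrix.toLinAlgEquiv' : Matrix (Fin d) (Fin d) K ≃ₐ[K] _).toAlgHom M q

theorem modelRep_δ_single (hn : n ≤ 3) (hp : p ∈ paramSpace K (n + 2)) :
    modelRep hp δ (Pi.single 0 1) = p.1 0 • Pi.single 1 1 := by
  rw [modelRep_δ, Matrix.toLinAlgEquiv'_apply, modelS_mulVec_single hn]

theorem modelRep_σ₁_single (hn : n ≤ 3) (hp : p ∈ paramSpace K (n + 2)) :
    modelRep hp σ₁ (Pi.single 0 1) = p.1 0 • Pi.single 0 1 := by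
  rw [σ₁_apply_eq_smul_iff, modelRep_δ_single hn, modelRep_τ, Matrix.toLinAlgEquiv'_apply,
    modelT_mulVec_single hn]

theorem modelRep_identity_one (hn : n ≤ 3) (hp : p ∈ paramSpace K (n + 2)) :
    aeval (modelRep hp σ₁) (P p.1 0) (aeval (modelRep hp σ₂) (P p.1 1) (Pi.single 0 1)) =
      Q p 0 1 • Pi.single 0 1 := by
  apply apply_injective (modelRep hp) δ
  rw [apply_δ_aeval_σ₁, map_smul, modelRep_δ_single hn, smul_smul, ← model_identity hn hp,
    modelRep_σ₂, modelRep_δ, aeval_toLinAlgEquiv', aeval_toLinAlgEquiv',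
    Matrix.toLinAlgEquiv'_apply]

/-- Exchanging λ₁ and λ_s leaves λ₀ and the model unchanged by `model_swap`, so the case s = 1
suffices. -/
theorem modelRep_identity (hn : n ≤ 3) (hp : p ∈ paramSpace K (n + 2)) {s : Fin (n + 2)}
    (hs : s ≠ 0) :
    aeval (modelRep hp σ₁) (P p.1 0) (aeval (modelRep hp σ₂) (P p.1 s) (Pi.single 0 1)) =
      Q p 0 s • Pi.single 0 1 := by
  obtain ⟨-, hS, hT⟩ := model_swap hn p hs
  have h0 : Equiv.swap 1 s 0 = 0 := Equiv.swap_apply_of_ne_of_ne (by simp) hs.symm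
  have h := modelRep_identity_one hn (comp_perm_mem_paramSpace hp (Equiv.swap 1 s))
  rw [modelRep_congr hp _ hS hT, P_comp_perm, P_comp_perm, Q_comp_perm, h0,
    Equiv.swap_apply_left] at h
  exact h

/-- Otherwise P₁(B)e₀ without its factor B - λ₀ is a λ₀-eigenvector of σ₂. Such vectors are the
images under δ of those of σ₁, hence multiples of δe₀ = λ₀e₁, against `model_cyclic`. -/
theorem modelRep_aeval_ne_zero [IsAlgClosed K] (hn : n ≤ 3) (hp : p ∈ paramSpace K (n + 2))
    (hirr : (modelRep hp).IsIrreducible) :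
    aeval (modelRep hp σ₂) (P p.1 1) (Pi.single 0 1) ≠ 0 := by
  intro h
  obtain ⟨c, -, hpair⟩ := exists_isSimplePair hirr
  rw [P_eq_mul_prod_erase p.1 (show (0 : Fin (n + 2)) ≠ 1 by simp), map_mul,
    Module.End.mul_apply] at h
  obtain ⟨j, hj, hw⟩ := model_cyclic hn hp
  rw [← aeval_toLinAlgEquiv', ← modelRep_σ₂ hp] at hw
  set w := aeval (modelRep hp σ₂)
    (∏ i ∈ (Finset.univ.erase 1).erase (0 : Fin (n + 2)), (X - C (p.1 i))) (Pi.single 0 1)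
  have hw' : modelRep hp σ₂ w = p.1 0 • w := by
    rw [map_sub, aeval_X, aeval_C, LinearMap.sub_apply, Module.algebraMap_end_apply,
      sub_eq_zero] at h
    exact h
  obtain ⟨w', hw''⟩ : ∃ w', modelRep hp δ w' = w :=
    ⟨modelRep hp δ⁻¹ w, by simp [← Module.End.mul_apply, ← map_mul]⟩
  have h1 : modelRep hp σ₁ w' = p.1 0 • w' := by
    apply apply_injective (modelRep hp) δ
    rw [apply_δ_apply_σ₁, hw'', hw', map_smul, hw'']
  obtain ⟨k, hk⟩ := Submodule.mem_span_singleton.1 <| hpair.mem_span_singleton_of_eigenvector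
    (by rw [Module.finrank_fin_fun]; omega) (hp.1 0)
    (Pi.single_ne_zero_iff.2 one_ne_zero : (Pi.single 0 1 : Fin (n + 2) → K) ≠ 0)
    ((σ₁_apply_eq_smul_iff _).1 (modelRep_σ₁_single hn hp)) ((σ₁_apply_eq_smul_iff _).1 h1)
  apply hw
  rw [← hw'', ← hk, map_smul, modelRep_δ_single hn]
  simp [hj]

end ModelIdentity

/-! ### The identity on an arbitrary simple module, and Q ≠ 0 -/

section Identity

theorem isIrreducible_of_equiv {K V W : Type*} [Field K] [AddCommGroup V] [Module K V]
    [AddCommGroup W] [Module K W] {ρ : Representation K B3 V} {ρ' : Representation K B3 W}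
    (hρ : ρ.IsIrreducible) (e : ρ.Equiv ρ') : ρ'.IsIrreducible := by
  have := nontrivial_of_isIrreducible hρ
  have := e.toLinearEquiv.symm.toEquiv.nontrivial
  have hinj := Submodule.comap_injective_of_surjective
    (f := e.toLinearEquiv.toLinearMap) e.toLinearEquiv.surjective
  refine isIrreducible_of_forall fun N hN => ?_
  refine (eq_bot_or_eq_top_of_isIrreducible hρ (N.comap e.toLinearEquiv.toLinearMap) ?_).imp
    (fun h => hinj ?_) (fun h => hinj ?_)
  · intro g v hv
    have he : e.toLinearEquiv (ρ g v) = ρ' g (e.toLinearEquiv v) :=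
      LinearMap.congr_fun (e.isIntertwining' g) v
    change e.toLinearEquiv (ρ g v) ∈ N
    rw [he]
    exact hN g _ hv
  · rw [h, Submodule.comap_bot, LinearEquiv.ker]
  · rw [h, Submodule.comap_top]

variable {K V : Type*} [Field K] [AddCommGroup V] [Module K V]
  [FiniteDimensional K V] {ρ : Representation K B3 V} {d : ℕ} {p : Param K d} {r s : Fin d}

theorem HasParam.σ₁_apply_aeval (h : HasParam ρ p) (v : V) :
    ρ σ₁ (aeval (ρ σ₁) (P p.1 r) v) = p.1 r • aeval (ρ σ₁) (P p.1 r) v := by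
  have h' := LinearMap.congr_fun (LinearMap.aeval_self_charpoly (ρ σ₁)) v
  rw [h.charpoly_eq, ← X_sub_C_mul_P p.1 r, map_mul, Module.End.mul_apply, map_sub, aeval_X,
    aeval_C, LinearMap.sub_apply, Module.algebraMap_end_apply, LinearMap.zero_apply,
    sub_eq_zero] at h'
  exact h'

theorem HasParam.exists_eigenvector (h : HasParam ρ p) (r : Fin d) :
    ∃ u : V, u ≠ 0 ∧ ρ σ₁ u = p.1 r • u := by
  have h' : (ρ σ₁).charpoly.IsRoot (p.1 r) := by
    rw [h.charpoly_eq, ← X_sub_C_mul_P p.1 r, Polynomial.IsRoot, eval_mul]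
    simp
  obtain ⟨u, hu⟩ := ((Module.End.hasEigenvalue_iff_isRoot_charpoly _ _).2 h').exists_hasEigenvector
  exact ⟨u, hu.2, hu.apply_eq_smul⟩

variable [IsAlgClosed K]

theorem mem_span_singleton_of_σ₁_apply (hρ : ρ.IsIrreducible) (hd : Module.finrank K V ≤ 5)
    {l : K} (hl : l ≠ 0) {u v : V} (hu0 : u ≠ 0) (hu : ρ σ₁ u = l • u) (hv : ρ σ₁ v = l • v) :
    ∃ k : K, k • u = v := by
  obtain ⟨c, -, h⟩ := exists_isSimplePair hρ
  exact Submodule.mem_span_singleton.1 <| h.mem_span_singleton_of_eigenvector hd hl hu0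
    ((σ₁_apply_eq_smul_iff _).1 hu) ((σ₁_apply_eq_smul_iff _).1 hv)

/-- A permutation moves r, s to 0, 1, and the module becomes the model. There the image of u is a
multiple of e₀ because the eigenspace is a line. -/
theorem HasParam.aeval_aeval_apply (hd5 : d ≤ 5) (hρ : ρ.IsIrreducible) (h : HasParam ρ p)
    (hrs : r ≠ s) {u : V} (hu0 : u ≠ 0) (hu : ρ σ₁ u = p.1 r • u) :
    aeval (ρ σ₂) (P p.1 s) u ≠ 0 ∧
      aeval (ρ σ₁) (P p.1 r) (aeval (ρ σ₂) (P p.1 s) u) = Q p r s • u := by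
  obtain ⟨n, rfl⟩ : ∃ n, d = n + 2 := by
    refine ⟨d - 2, ?_⟩
    have := r.2
    have := s.2
    have := Fin.val_ne_of_ne hrs
    omega
  have hn : n ≤ 3 := by omega
  obtain ⟨π, rfl, rfl⟩ := exists_perm_apply hrs
  have hq := h.comp_perm π
  rw [← P_comp_perm, ← P_comp_perm, ← Q_comp_perm]
  obtain ⟨e⟩ := hq.nonempty_equiv_modelRep hρ (by omega) hd5
  have hirr := isIrreducible_of_equiv hρ e
  have he : ∀ g v, e.toLinearEquiv (ρ g v) = modelRep hq.mem g (e.toLinearEquiv v) :=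
    fun g v => LinearMap.congr_fun (e.isIntertwining' g) v
  have heu : modelRep hq.mem σ₁ (e.toLinearEquiv u) = p.1 (π 0) • e.toLinearEquiv u := by
    rw [← he, hu, map_smul]
  obtain ⟨k, hk⟩ := mem_span_singleton_of_σ₁_apply hirr (by rw [Module.finrank_fin_fun]; omega)
    (h.mem.1 (π 0))
    (Pi.single_ne_zero_iff.2 one_ne_zero : (Pi.single 0 1 : Fin (n + 2) → K) ≠ 0)
    (modelRep_σ₁_single hn hq.mem) heu
  have hk0 : k ≠ 0 := by
    rintro rfl
    rw [zero_smul, eq_comm, LinearEquiv.map_eq_zero_iff] at hk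
    exact hu0 hk
  have haeval : ∀ g q v, e.toLinearEquiv (aeval (ρ g) q v) =
      aeval (modelRep hq.mem g) q (e.toLinearEquiv v) := fun g q v =>
    map_aeval_apply (φ := e.toLinearEquiv.toLinearMap) (he g) q v
  constructor
  · intro h0
    have h1 := congrArg e.toLinearEquiv h0
    rw [haeval, map_zero, ← hk, map_smul, smul_eq_zero_iff_right hk0] at h1
    exact modelRep_aeval_ne_zero hn hq.mem hirr h1
  · apply e.toLinearEquiv.injective
    rw [haeval, haeval, map_smul, ← hk, map_smul, map_smul, modelRep_identity_one hn hq.mem,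
      smul_comm]

theorem HasParam.Q_ne_zero (hd5 : d ≤ 5) (hρ : ρ.IsIrreducible) (h : HasParam ρ p)
    (hrs : r ≠ s) : Q p r s ≠ 0 := by
  obtain ⟨c, hζ, hpair⟩ := exists_isSimplePair hρ
  obtain ⟨u, hu0, hu⟩ := h.exists_eigenvector r
  obtain ⟨h1, h2⟩ := h.aeval_aeval_apply hd5 hρ hrs hu0 hu
  intro hQ
  rw [hQ, zero_smul] at h2
  have hB : ∀ v, ρ δ (ρ σ₂ v) = ρ σ₁ (ρ δ v) := by
    intro v
    apply apply_injective ρ δ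
    rw [apply_δ_apply_σ₁, apply_δ_apply_δ, apply_δ_apply_δ, hζ]
    simp
  obtain ⟨u', hu'⟩ : ∃ u', ρ δ u' = u :=
    ⟨ρ δ⁻¹ u, by simp [← Module.End.mul_apply, ← map_mul]⟩
  -- P_s(B)u is a λ_s-eigenvector of σ₂, by Cayley–Hamilton carried from σ₁ to σ₂ by δ. As ζ is
  -- scalar, δ also carries σ₂ back to σ₁.
  have hw : ρ σ₁ (ρ δ (aeval (ρ σ₂) (P p.1 s) u)) =
      p.1 s • ρ δ (aeval (ρ σ₂) (P p.1 s) u) := by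
    rw [← hB, ← map_smul, ← hu', ← apply_δ_aeval_σ₁, ← apply_δ_apply_σ₁, h.σ₁_apply_aeval,
      map_smul]
  refine (h.aeval_aeval_apply hd5 hρ hrs.symm ?_ hw).1 ?_
  · intro h0
    exact h1 (apply_injective ρ δ (h0.trans (map_zero _).symm))
  · rw [← apply_δ_aeval_σ₁, h2, map_zero]

theorem HasParam.aeval_ne_zero (hd5 : d ≤ 5) (hρ : ρ.IsIrreducible) (h : HasParam ρ p)
    (hrs : r ≠ s) : aeval (ρ σ₁) (P p.1 r) ≠ 0 := by
  intro h0
  obtain ⟨u, hu0, hu⟩ := h.exists_eigenvector r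
  have h2 := (h.aeval_aeval_apply hd5 hρ hrs hu0 hu).2
  rw [h0, LinearMap.zero_apply, eq_comm, smul_eq_zero] at h2
  exact h2.elim (h.Q_ne_zero hd5 hρ hrs) hu0

/-- By Cayley–Hamilton, P_r(A)v is zero or a λ_r-eigenvector of A, so the identity on eigenvectors
suffices. -/
theorem HasParam.aeval_mul_aeval_mul_aeval (hd5 : d ≤ 5) (hρ : ρ.IsIrreducible)
    (h : HasParam ρ p) (hrs : r ≠ s) :
    aeval (ρ σ₁) (P p.1 r) * aeval (ρ σ₂) (P p.1 s) * aeval (ρ σ₁) (P p.1 r) =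
      Q p r s • aeval (ρ σ₁) (P p.1 r) := by
  ext v
  simp only [Module.End.mul_apply, LinearMap.smul_apply]
  by_cases h0 : aeval (ρ σ₁) (P p.1 r) v = 0
  · rw [h0, map_zero, map_zero, smul_zero]
  · exact (h.aeval_aeval_apply hd5 hρ hrs h0 (h.σ₁_apply_aeval v)).2

end Identity

/-! ### Irreducibility of the model when Q ≠ 0 -/

section Irreducible

variable {K : Type*} [Field K]

theorem charpoly_eq_mul_of_le_comap [Infinite K] {V : Type*} [AddCommGroup V] [Module K V]
    [FiniteDimensional K V] {f : Module.End K V} {N : Submodule K V} (h : N ≤ N.comap f) :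
    f.charpoly = (f.restrict h).charpoly * (N.mapQ N f h).charpoly := by
  refine Polynomial.funext fun x => ?_
  have hx : N ≤ N.comap (algebraMap K (Module.End K V) x - f) := fun v hv =>
    N.sub_mem (N.smul_mem x hv) (h hv)
  rw [eval_mul, LinearMap.eval_charpoly, LinearMap.eval_charpoly, LinearMap.eval_charpoly,
    LinearMap.det_eq_det_mul_det N _ hx]
  congr 2
  ext v
  simp

/-- The factor X - λᵢ is removed from h, so f divides Pᵢ and has a root λ_s with index s ≠ i;
removing that factor from f leaves h dividing P_s. Working with indices instead of values permits
repeated eigenvalues. -/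
theorem exists_dvd_P_of_mul_eq_prod [IsAlgClosed K] {d : ℕ} {l : Fin d → K} {f h : K[X]}
    (hf : f.degree ≠ 0) (hfh : f * h = ∏ i, (X - C (l i))) {i : Fin d} (hi : X - C (l i) ∣ h) :
    ∃ s, s ≠ i ∧ f ∣ P l i ∧ h ∣ P l s := by
  obtain ⟨h', rfl⟩ := hi
  have h1 : f * h' = P l i := by
    refine mul_left_cancel₀ (X_sub_C_ne_zero (l i)) ?_
    rw [X_sub_C_mul_P, ← hfh]
    ring
  obtain ⟨x, hx⟩ := IsAlgClosed.exists_root f hf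
  have h2 : (P l i).eval x = 0 := by rw [← h1, eval_mul, hx.eq_zero, zero_mul]
  rw [P, eval_prod, Finset.prod_eq_zero_iff] at h2
  obtain ⟨s, hs, hsx⟩ := h2
  have hxs : x = l s := by simpa [sub_eq_zero] using hsx
  subst hxs
  obtain ⟨f', rfl⟩ := dvd_iff_isRoot.2 hx
  refine ⟨s, (Finset.mem_erase.1 hs).1, Dvd.intro _ h1, Dvd.intro_left f' ?_⟩
  refine mul_left_cancel₀ (X_sub_C_ne_zero (l s)) ?_
  rw [X_sub_C_mul_P, ← hfh]
  ring

variable {V : Type*} [AddCommGroup V] [Module K V] [FiniteDimensional K V]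
  {ρ : Representation K B3 V}

theorem degree_charpoly_ne_zero [Nontrivial V] (f : Module.End K V) : f.charpoly.degree ≠ 0 := by
  rw [degree_eq_natDegree (LinearMap.charpoly_monic f).ne_zero, LinearMap.charpoly_natDegree]
  exact_mod_cast Module.finrank_pos.ne'

variable [IsAlgClosed K]

/-- On a reducible representation some products of the operators `P_r(σ₁)` and `P_s(σ₂)` vanish,
where one of the indices can be prescribed. -/
theorem exists_aeval_aeval_eq_zero {d : ℕ} {l : Fin d → K}
    (hl : (ρ σ₁).charpoly = ∏ i, (X - C (l i))) {N : Submodule K V}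
    (hN : ∀ g, ∀ v ∈ N, ρ g v ∈ N) (hbot : N ≠ ⊥) (htop : N ≠ ⊤) (i : Fin d) :
    ∃ s, s ≠ i ∧ ((∀ v, aeval (ρ σ₁) (P l i) (aeval (ρ σ₂) (P l s) v) = 0) ∨
      ∀ v, aeval (ρ σ₂) (P l s) (aeval (ρ σ₁) (P l i) v) = 0) := by
  have hle : N ≤ N.comap (ρ σ₁) := hN σ₁
  have : Infinite K := IsAlgClosed.instInfinite
  have : Nontrivial N := Submodule.nontrivial_iff_ne_bot.2 hbot
  have : Nontrivial (V ⧸ N) := Submodule.Quotient.nontrivial_iff.2 htop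
  have hmul := (charpoly_eq_mul_of_le_comap hle).symm.trans hl
  -- By Cayley–Hamilton on N and on V/N, multiples of the first characteristic polynomial kill N,
  -- and multiples of the second map V into N.
  have hsub : ∀ q, ((ρ σ₁).restrict hle).charpoly ∣ q → ∀ v ∈ N, aeval (ρ σ₁) q v = 0 := by
    intro q hq v hv
    have h := map_aeval_apply (f := (ρ σ₁).restrict hle) (g := ρ σ₁) (φ := N.subtype)
      (fun _ => rfl) q ⟨v, hv⟩
    rw [aeval_apply_eq_zero_of_dvd hq (LinearMap.aeval_self_charpoly _), LinearMap.zero_apply,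
      map_zero] at h
    exact h.symm
  have hquot : ∀ q, (N.mapQ N (ρ σ₁) hle).charpoly ∣ q → ∀ v, aeval (ρ σ₁) q v ∈ N := by
    intro q hq v
    have h := map_aeval_apply (f := ρ σ₁) (g := N.mapQ N (ρ σ₁) hle) (φ := N.mkQ)
      (fun _ => rfl) q v
    rw [aeval_apply_eq_zero_of_dvd hq (LinearMap.aeval_self_charpoly _), LinearMap.zero_apply] at h
    exact (Submodule.Quotient.mk_eq_zero N).1 h
  have hδ : ∀ v, ρ δ (ρ δ⁻¹ v) = v := fun v => by simp [← Module.End.mul_apply, ← map_mul]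
  have hdvd : X - C (l i) ∣ ((ρ σ₁).restrict hle).charpoly * (N.mapQ N (ρ σ₁) hle).charpoly := by
    rw [hmul]
    exact Finset.dvd_prod_of_mem _ (Finset.mem_univ i)
  -- Whichever of N and V/N has λᵢ as an eigenvalue, the index s comes from the other one. One
  -- operator maps V into N and the other kills N; stability of N under δ and its inverse transfers
  -- this between σ₁ and σ₂.
  rcases (prime_X_sub_C (l i)).dvd_or_dvd hdvd with h | h
  · obtain ⟨s, hs, h1, h2⟩ := exists_dvd_P_of_mul_eq_prod (degree_charpoly_ne_zero _)
      ((mul_comm _ _).trans hmul) h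
    refine ⟨s, hs, Or.inr fun v => ?_⟩
    have hmem := hN δ⁻¹ _ (hquot _ h1 v)
    rw [← hδ (aeval (ρ σ₁) (P l i) v), ← apply_δ_aeval_σ₁, hsub _ h2 _ hmem, map_zero]
  · obtain ⟨s, hs, h1, h2⟩ := exists_dvd_P_of_mul_eq_prod (degree_charpoly_ne_zero _) hmul h
    refine ⟨s, hs, Or.inl fun v => hsub _ h1 _ ?_⟩
    rw [← hδ v, ← apply_δ_aeval_σ₁]
    exact hN δ _ (hquot _ h2 _)

theorem isIrreducible_modelRep {d : ℕ} (hd1 : 1 ≤ d) (hd5 : d ≤ 5) {p : Param K d}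
    (hp : p ∈ paramSpace K d) (hQ : ∀ r s, r ≠ s → Q p r s ≠ 0) :
    (modelRep hp).IsIrreducible := by
  have : Infinite K := IsAlgClosed.instInfinite
  have : Nonempty (Fin d) := ⟨⟨0, hd1⟩⟩
  refine isIrreducible_of_forall fun N hN => ?_
  by_contra! hN'
  -- The index 0 is prescribed because the identity in the model is known at e₀, the eigenvector for
  -- λ₀.
  obtain ⟨s, hs, h⟩ := exists_aeval_aeval_eq_zero (charpoly_modelRep hd1 hd5 hp) hN hN'.1 hN'.2
    ⟨0, hd1⟩
  obtain ⟨n, rfl⟩ : ∃ n, d = n + 2 := by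
    refine ⟨d - 2, ?_⟩
    have := s.2
    have := Fin.val_ne_of_ne hs
    simp only at this
    omega
  change s ≠ 0 at hs
  change (∀ v, aeval (modelRep hp σ₁) (P p.1 0) (aeval (modelRep hp σ₂) (P p.1 s) v) = 0) ∨
    ∀ v, aeval (modelRep hp σ₂) (P p.1 s) (aeval (modelRep hp σ₁) (P p.1 0) v) = 0 at h
  have hid := modelRep_identity (by omega) hp hs
  have h0 : (Pi.single 0 1 : Fin (n + 2) → K) ≠ 0 := Pi.single_ne_zero_iff.2 one_ne_zero
  rcases h with h | h
  · rw [h, eq_comm, smul_eq_zero] at hid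
    exact hid.elim (hQ 0 s hs.symm) h0
  -- Here P_s(B)P₀(A) = 0. Applied to P_s(B)e₀ it gives Q₀ₛP_s(B)e₀ = 0, hence P_s(B)e₀ = 0, and the
  -- identity makes Q₀ₛe₀ vanish as well.
  · have h1 := h (aeval (modelRep hp σ₂) (P p.1 s) (Pi.single 0 1))
    rw [hid, map_smul, smul_eq_zero_iff_right (hQ 0 s hs.symm)] at h1
    rw [h1, map_zero, eq_comm, smul_eq_zero] at hid
    exact hid.elim (hQ 0 s hs.symm) h0

end Irreducible

/-! ### The bijection between classes and orbits -/

section Classification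

variable {K : Type*} [Field K] [IsAlgClosed K] {d : ℕ}

theorem HasParam.notMem_excludedLocus (hd5 : d ≤ 5) {V : Type*} [AddCommGroup V] [Module K V]
    [FiniteDimensional K V] {ρ : Representation K B3 V} {p : Param K d} (hρ : ρ.IsIrreducible)
    (h : HasParam ρ p) : p ∉ excludedLocus K d := fun hp =>
  have ⟨_, _, hrs, hQ⟩ := exists_Q_eq_zero_of_isExcluded hp
  h.Q_ne_zero hd5 hρ hrs hQ

theorem nonempty_equiv_iff_exists_hasParam (hd1 : 1 ≤ d) (hd5 : d ≤ 5) {V W : Type*}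
    [AddCommGroup V] [Module K V] [FiniteDimensional K V] [AddCommGroup W] [Module K W]
    [FiniteDimensional K W] {ρ : Representation K B3 V} {ρ' : Representation K B3 W}
    (hρ : ρ.IsIrreducible) (hρ' : ρ'.IsIrreducible) (hd : Module.finrank K V = d) :
    Nonempty (ρ.Equiv ρ') ↔ ∃ p : Param K d, HasParam ρ p ∧ HasParam ρ' p := by
  constructor
  · rintro ⟨e⟩
    obtain ⟨p, hp⟩ := exists_hasParam hρ hd1 hd5 hd
    exact ⟨p, hp, hp.of_equiv e⟩
  · rintro ⟨p, hp, hp'⟩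
    obtain ⟨e⟩ := hp.nonempty_equiv_modelRep hρ hd1 hd5
    obtain ⟨e'⟩ := hp'.nonempty_equiv_modelRep hρ' hd1 hd5
    exact ⟨e.trans e'.symm⟩

/-- A chosen parameter of each module descends to classes because parameters form one orbit;
injectivity is determination by the parameter, and surjectivity comes from the models, which are
simple off the excluded locus. -/
theorem exists_equiv_paramOrbits (hd1 : 1 ≤ d) (hd5 : d ≤ 5) :
    ∃ Φ : SimpleClasses K d ≃ ParamOrbits K d,
      ∀ (ρ : {ρ : Representation K B3 (Fin d → K) // ρ.IsIrreducible})
        (p : ↥(paramSpace K d \ excludedLocus K d)),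
        HasParam ρ.1 p.1 ↔ Φ (Quotient.mk _ ρ) = Quotient.mk _ p := by
  have : Infinite K := IsAlgClosed.instInfinite
  have hex : ∀ ρ : {ρ : Representation K B3 (Fin d → K) // ρ.IsIrreducible},
      ∃ p : ↥(paramSpace K d \ excludedLocus K d), HasParam ρ.1 p.1 := fun ρ =>
    have ⟨p, hp⟩ := exists_hasParam ρ.2 hd1 hd5 (Module.finrank_fin_fun K)
    ⟨⟨p, hp.mem, hp.notMem_excludedLocus hd5 ρ.2⟩, hp⟩
  choose φ hφ using hex
  have hiff : ∀ ρ p, HasParam ρ.1 p.1 ↔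
      (Quotient.mk _ (φ ρ) : ParamOrbits K d) = Quotient.mk _ p := fun ρ p =>
    have := nontrivial_of_isIrreducible ρ.2
    ((hφ ρ).iff_sameOrbit).trans (Quotient.eq (r := orbitSetoid K d)).symm
  have hequiv : ∀ ρ ρ' : {ρ : Representation K B3 (Fin d → K) // ρ.IsIrreducible},
      Nonempty (ρ.1.Equiv ρ'.1) ↔
        (Quotient.mk _ (φ ρ) : ParamOrbits K d) = Quotient.mk _ (φ ρ') := by
    intro ρ ρ'
    rw [← hiff]
    refine ⟨fun ⟨e⟩ => (hφ ρ').of_equiv e.symm, fun h => ?_⟩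
    exact (nonempty_equiv_iff_exists_hasParam hd1 hd5 ρ.2 ρ'.2 (Module.finrank_fin_fun K)).2
      ⟨_, h, hφ ρ'⟩
  let Ψ : SimpleClasses K d → ParamOrbits K d :=
    Quotient.lift (fun ρ => Quotient.mk _ (φ ρ)) fun ρ ρ' h => (hequiv ρ ρ').1 h
  have hΨ : Function.Bijective Ψ := by
    constructor
    · rintro ⟨ρ⟩ ⟨ρ'⟩ h
      exact Quotient.sound ((hequiv ρ ρ').2 h)
    · rintro ⟨p⟩
      have hirr := isIrreducible_modelRep hd1 hd5 p.2.1 fun r s hrs hQ =>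
        p.2.2 (isExcluded_of_Q_eq_zero p.2.1 hrs hQ)
      exact ⟨Quotient.mk _ ⟨modelRep p.2.1, hirr⟩,
        (hiff ⟨_, hirr⟩ p).1 (hasParam_modelRep hd1 hd5 p.2.1)⟩
  exact ⟨Equiv.ofBijective Ψ hΨ, hiff⟩

end Classification

end B3

open B3 in
theorem mainTheorem1 {K : Type*} [Field K] [IsAlgClosed K] (d : ℕ) (hd1 : 1 ≤ d) (hd5 : d ≤ 5) :
    -- every simple module has a parameter, unique up to permuting the eigenvalues,
    -- and all the `Q r s` are nonzero there
    (∀ (V : Type*) [AddCommGroup V] [Module K V] [FiniteDimensional K V]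
        (ρ : Representation K B3 V), ρ.IsIrreducible → Module.finrank K V = d →
        ∃ p : Param K d, (∀ q : Param K d, HasParam ρ q ↔ SameOrbit p q) ∧
          ∀ r s, r ≠ s → Q p r s ≠ 0) ∧
    -- a simple module is determined by its parameter
    (∀ (V : Type*) [AddCommGroup V] [Module K V] [FiniteDimensional K V]
        (W : Type*) [AddCommGroup W] [Module K W] [FiniteDimensional K W]
        (ρ : Representation K B3 V) (τ : Representation K B3 W),
        ρ.IsIrreducible → τ.IsIrreducible →
        Module.finrank K V = d → Module.finrank K W = d →
        (Nonempty (ρ.Equiv τ) ↔ ∃ p : Param K d, HasParam ρ p ∧ HasParam τ p)) ∧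
    -- a simple module with a given parameter exists if and only if all `Q r s` are nonzero
    (∀ p ∈ paramSpace K d,
        (∃ ρ : Representation K B3 (Fin d → K), ρ.IsIrreducible ∧ HasParam ρ p) ↔
          ∀ r s, r ≠ s → Q p r s ≠ 0) ∧
    -- `Q r s` is the scalar with `P_r(A) P_s(B) P_r(A) = Q_{rs} P_r(A)`, and `P_r(A) ≠ 0`
    (∀ (V : Type*) [AddCommGroup V] [Module K V] [FiniteDimensional K V]
        (ρ : Representation K B3 V) (p : Param K d), ρ.IsIrreducible → HasParam ρ p →
        ∀ r s, r ≠ s → aeval (ρ σ₁) (P p.1 r) ≠ 0 ∧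
          aeval (ρ σ₁) (P p.1 r) * aeval (ρ σ₂) (P p.1 s) * aeval (ρ σ₁) (P p.1 r) =
            Q p r s • aeval (ρ σ₁) (P p.1 r)) ∧
    -- equivalence classes correspond bijectively to orbits in `X_d \ N_d`
    (∃ Φ : SimpleClasses K d ≃ ParamOrbits K d,
        ∀ (ρ : {ρ : Representation K B3 (Fin d → K) // ρ.IsIrreducible})
          (p : ↥(paramSpace K d \ excludedLocus K d)),
          HasParam ρ.1 p.1 ↔ Φ (Quotient.mk _ ρ) = Quotient.mk _ p) := by
  have : Infinite K := IsAlgClosed.instInfinite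
  refine ⟨?_, ?_, ?_, ?_, exists_equiv_paramOrbits hd1 hd5⟩
  · intro V _ _ _ ρ hρ hd
    have := nontrivial_of_isIrreducible hρ
    obtain ⟨p, hp⟩ := exists_hasParam hρ hd1 hd5 hd
    exact ⟨p, fun q => hp.iff_sameOrbit, fun r s hrs => hp.Q_ne_zero hd5 hρ hrs⟩
  · intro V _ _ _ W _ _ _ ρ τ hρ hτ hd _
    exact nonempty_equiv_iff_exists_hasParam hd1 hd5 hρ hτ hd
  · intro p hp
    refine ⟨fun ⟨ρ, hρ, h⟩ r s hrs => h.Q_ne_zero hd5 hρ hrs, fun hQ => ?_⟩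
    exact ⟨modelRep hp, isIrreducible_modelRep hd1 hd5 hp hQ, hasParam_modelRep hd1 hd5 hp⟩
  · intro V _ _ _ ρ p hρ hp r s hrs
    exact ⟨hp.aeval_ne_zero hd5 hρ hrs, hp.aeval_mul_aeval_mul_aeval hd5 hρ hrs⟩
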